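/- Let $\mathbb{F}_q$ be a finite field, let $a_1,b_1,a_2,b_2,a_3,b_3\in\mathbb{F}_q$ be non-zero, and let $N_1,N_2,N_3$ be independent $\mathbb{F}_q$-valued random variables. Consider the memoryless two-way wiretap channel with $$Y_1=a_1X_1+b_1X_2+N_1,\qquad Y_2=a_2X_1+b_2X_2+N_2,\qquad Z=a_3X_1+b_3X_2+N_3,$$ where User $i$ ($i=1,2$) has the input $X_i$ and the output $Y_i$, $Z$ is the output at the eavesdropper, and the noise $(N_1,N_2,N_3)$ is independent of the inputs and drawn afresh in each use of the channel. A non-adaptive code $\mathcal{C}_n$ of length $n$ with rates $(R_{1,n},R_{2,n})$ consists of message sets $\mathcal{M}_1,\mathcal{M}_2$ with $|\mathcal{M}_i|=e^{nR_{i,n}}$, of stochastic encoders that map the message $M_i\in\mathcal{M}_i$ of User $i$ to an input word $X_i^n\in\mathbb{F}_q^n$, independently for the two users, and of decoders by which User 1 estimates $M_2$ from $(X_1^n,Y_1^n)$ and User 2 estimates $M_1$ from $(X_2^n,Y_2^n)$. The messages $M_1,M_2$ are independent and uniform, and $P_e(\mathcal{C}_n)$ is the probability that at least one of the two estimates is wrong.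 Let $\mathcal{C}_{J,S,N,2}$ be the set of all pairs $(R_1,R_2)$ for which there is a sequence of non-adaptive codes $\mathcal{C}_n$, one for each length $n$, with $R_{i,n}\to R_i$ for $i=1,2$, $P_e(\mathcal{C}_n)\to 0$ and $I(M_1,M_2;Z^n)\to 0$ as $n\to\infty$ (strong joint secrecy). Let $\mathcal{C}_{I,S,N,2}$ be defined in the same way, with the last condition replaced by $I(M_1;Z^n)\to 0$ and $I(M_2;Z^n)\to 0$ (strong individual secrecy). Let $\log$ be the natural logarithm, let $H$ be the Shannon entropy in nats, and let $$\mathcal{A}_J=\left\{(R_1,R_2)\in[0,\infty)^2 :\ R_1\le\log q-H(N_2),\ R_2\le\log q-H(N_1),\ R_1+R_2\le\log q+H(N_3)-H(N_1)-H(N_2)\right\},$$ $$\mathcal{A}_I=\left\{(R_1,R_2)\in[0,\infty)^2 :\ R_1\le\log q-H(N_2),\ R_2\le\log q-H(N_1),\ \max\{R_1,R_2\}\le\log q+H(N_3)-H(N_1)-H(N_2)\right\}.$$ Then $$\mathcal{A}_J\subset\mathcal{C}_{J,S,N,2}\qquad\text{and}\qquad\mathcal{A}_I\subset\mathcal{C}_{I,S,N,2}.$$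 -/

import Mathlib

open Filter Topology
open scoped ENNReal

noncomputable section

namespace TwoWayWiretap

/-- Shannon entropy (in nats) `H = -∑ₓ P(x) log P(x)` of a distribution on a finite set. -/
def entropy {A : Type*} [Fintype A] (P : PMF A) : ℝ :=
  -∑ a, (P a).toReal * Real.log (P a).toReal

/-- Mutual information (in nats) `I(A;B) = ∑ P(a,b) log (P(a,b) / (P(a) P(b)))` of a pair with
joint distribution `P` on a product of finite sets.  Terms with `P(a,b) = 0` vanish; if
`P(a,b) > 0`, both marginals are positive. -/
def mutualInfo {A B : Type*} [Fintype A] [Fintype B] (P : PMF (A × B)) : ℝ :=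
  ∑ a, ∑ b, (P (a, b)).toReal *
    Real.log ((P (a, b)).toReal /
      (((P.map Prod.fst) a).toReal * ((P.map Prod.snd) b).toReal))

/-- The product distribution `∏ᵢ Pᵢ` on `n`-tuples. -/
def piPMF {A : Type*} [Fintype A] {n : ℕ} (P : Fin n → PMF A) : PMF (Fin n → A) :=
  PMF.ofFintype (fun w => ∏ i, P i (w i)) (by
    classical
    have h := Finset.prod_univ_sum (R := ℝ≥0∞) (fun _ : Fin n => (Finset.univ : Finset A))
      (fun i a => P i a)
    rw [Fintype.piFinset_univ] at h
    rw [← h]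
    refine Finset.prod_eq_one fun i _ => ?_
    rw [← tsum_fintype (L := SummationFilter.unconditional A)]
    exact (P i).tsum_coe)

section Channel

variable {X₁ X₂ Y₁ Y₂ Z : Type*}

/-- A discrete memoryless two-way wiretap channel `P_{Y₁ Y₂ Z | X₁ X₂}`: the conditional law
of one triple of outputs, given one pair of inputs. -/
abbrev Channel (X₁ X₂ Y₁ Y₂ Z : Type*) := X₁ → X₂ → PMF (Y₁ × Y₂ × Z)

/-- The `n`-fold memoryless use of the channel. The `i`-th letter of the output word is the
`i`-th triple `(y₁, y₂, z)`. -/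
def Channel.memoryless [Fintype Y₁] [Fintype Y₂] [Fintype Z] (W : Channel X₁ X₂ Y₁ Y₂ Z)
    {n : ℕ} (x₁ : Fin n → X₁) (x₂ : Fin n → X₂) : PMF (Fin n → Y₁ × Y₂ × Z) :=
  piPMF fun i => W (x₁ i) (x₂ i)

variable (X₁ X₂ Y₁ Y₂) in
/-- A non-adaptive code of block length `n` with decoders of the second type. The message sets
have `L₁` and `L₂` elements. User `i` maps the message stochastically to a whole input word, and
estimates the other user's message from its own input word and its own output word. -/
structure NonadaptiveCode (n : ℕ) where
  /-- size of the message set of User 1 -/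
  L₁ : ℕ
  /-- size of the message set of User 2 -/
  L₂ : ℕ
  [neZero₁ : NeZero L₁]
  [neZero₂ : NeZero L₂]
  /-- stochastic encoder of User 1 -/
  enc₁ : Fin L₁ → PMF (Fin n → X₁)
  /-- stochastic encoder of User 2 -/
  enc₂ : Fin L₂ → PMF (Fin n → X₂)
  /-- decoder of User 1, estimating the message of User 2 -/
  dec₁ : (Fin n → X₁) → (Fin n → Y₁) → Fin L₂
  /-- decoder of User 2, estimating the message of User 1 -/
  dec₂ : (Fin n → X₂) → (Fin n → Y₂) → Fin L₁

attribute [instance] NonadaptiveCode.neZero₁ NonadaptiveCode.neZero₂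

namespace NonadaptiveCode

variable {n : ℕ}

/-- The rate `R₁` of User 1, determined by `|M₁| = e^{n R₁}`. -/
def rate₁ (C : NonadaptiveCode X₁ X₂ Y₁ Y₂ n) : ℝ := Real.log C.L₁ / n

/-- The rate `R₂` of User 2, determined by `|M₂| = e^{n R₂}`. -/
def rate₂ (C : NonadaptiveCode X₁ X₂ Y₁ Y₂ n) : ℝ := Real.log C.L₂ / n

variable [Fintype Y₁] [Fintype Y₂] [Fintype Z]

/-- The joint law of the input words and of the output word, given the two messages. -/
def condLaw (C : NonadaptiveCode X₁ X₂ Y₁ Y₂ n) (W : Channel X₁ X₂ Y₁ Y₂ Z)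
    (m₁ : Fin C.L₁) (m₂ : Fin C.L₂) :
    PMF ((Fin n → X₁) × (Fin n → X₂) × (Fin n → Y₁ × Y₂ × Z)) :=
  (C.enc₁ m₁).bind fun x₁ => (C.enc₂ m₂).bind fun x₂ =>
    (W.memoryless x₁ x₂).map fun w => (x₁, x₂, w)

/-- The average, over the pairs of messages, of the probability that at least one of the two
users decodes wrongly. -/
def errorProb (C : NonadaptiveCode X₁ X₂ Y₁ Y₂ n) (W : Channel X₁ X₂ Y₁ Y₂ Z) : ℝ :=
  (1 / ((C.L₁ : ℝ) * (C.L₂ : ℝ))) * ∑ m₁ : Fin C.L₁, ∑ m₂ : Fin C.L₂,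
    ((C.condLaw W m₁ m₂).toOuterMeasure
      {ω | C.dec₂ ω.2.1 (fun i => (ω.2.2 i).2.1) ≠ m₁ ∨
        C.dec₁ ω.1 (fun i => (ω.2.2 i).1) ≠ m₂}).toReal

/-- The joint law of `((M₁, M₂), Zⁿ)`, with independent and uniformly distributed messages. -/
def messageEveLaw (C : NonadaptiveCode X₁ X₂ Y₁ Y₂ n) (W : Channel X₁ X₂ Y₁ Y₂ Z) :
    PMF ((Fin C.L₁ × Fin C.L₂) × (Fin n → Z)) :=
  (PMF.uniformOfFintype (Fin C.L₁)).bind fun m₁ =>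
    (PMF.uniformOfFintype (Fin C.L₂)).bind fun m₂ =>
      (C.condLaw W m₁ m₂).map fun ω => ((m₁, m₂), fun i => (ω.2.2 i).2.2)

/-- The joint leakage `I(M₁, M₂; Zⁿ)`. -/
def leakage (C : NonadaptiveCode X₁ X₂ Y₁ Y₂ n) (W : Channel X₁ X₂ Y₁ Y₂ Z) : ℝ :=
  mutualInfo (C.messageEveLaw W)

/-- The individual leakage `I(M₁; Zⁿ)`. -/
def leakage₁ (C : NonadaptiveCode X₁ X₂ Y₁ Y₂ n) (W : Channel X₁ X₂ Y₁ Y₂ Z) : ℝ :=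
  mutualInfo ((C.messageEveLaw W).map fun p => (p.1.1, p.2))

/-- The individual leakage `I(M₂; Zⁿ)`. -/
def leakage₂ (C : NonadaptiveCode X₁ X₂ Y₁ Y₂ n) (W : Channel X₁ X₂ Y₁ Y₂ Z) : ℝ :=
  mutualInfo ((C.messageEveLaw W).map fun p => (p.1.2, p.2))

end NonadaptiveCode

variable [Fintype Y₁] [Fintype Y₂] [Fintype Z]

/-- `C_{J,S,N,2}`: the rate pairs that are achievable under the strong joint secrecy constraint
by non-adaptive codes with decoders of the second type. -/
def jointCapacityRegion (W : Channel X₁ X₂ Y₁ Y₂ Z) : Set (ℝ × ℝ) :=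
  {R | ∃ (C : ∀ n : ℕ, NonadaptiveCode X₁ X₂ Y₁ Y₂ n) (ε τ : ℕ → ℝ),
    Tendsto (fun n => (C n).rate₁) atTop (𝓝 R.1) ∧
    Tendsto (fun n => (C n).rate₂) atTop (𝓝 R.2) ∧
    Tendsto ε atTop (𝓝 0) ∧ Tendsto τ atTop (𝓝 0) ∧
    (∀ n, (C n).errorProb W ≤ ε n) ∧
    (∀ n, (C n).leakage W ≤ τ n)}

/-- `C_{I,S,N,2}`: the rate pairs that are achievable under the strong individual secrecy
constraint by non-adaptive codes with decoders of the second type. -/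
def individualCapacityRegion (W : Channel X₁ X₂ Y₁ Y₂ Z) : Set (ℝ × ℝ) :=
  {R | ∃ (C : ∀ n : ℕ, NonadaptiveCode X₁ X₂ Y₁ Y₂ n) (ε τ : ℕ → ℝ),
    Tendsto (fun n => (C n).rate₁) atTop (𝓝 R.1) ∧
    Tendsto (fun n => (C n).rate₂) atTop (𝓝 R.2) ∧
    Tendsto ε atTop (𝓝 0) ∧ Tendsto τ atTop (𝓝 0) ∧
    (∀ n, (C n).errorProb W ≤ ε n) ∧
    (∀ n, (C n).leakage₁ W ≤ τ n) ∧
    (∀ n, (C n).leakage₂ W ≤ τ n)}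

end Channel

section Additive

variable {F : Type*} [Field F]

/-- The additive two-way wiretap channel `Y₁ = a₁ X₁ + b₁ X₂ + N₁`, `Y₂ = a₂ X₁ + b₂ X₂ + N₂`,
`Z = a₃ X₁ + b₃ X₂ + N₃`, where `N₁, N₂, N₃` are independent with laws `P₁, P₂, P₃`. -/
def additiveChannel (a₁ b₁ a₂ b₂ a₃ b₃ : F) (P₁ P₂ P₃ : PMF F) : Channel F F F F F :=
  fun x₁ x₂ => P₁.bind fun n₁ => P₂.bind fun n₂ => P₃.map fun n₃ =>
    (a₁ * x₁ + b₁ * x₂ + n₁, a₂ * x₁ + b₂ * x₂ + n₂, a₃ * x₁ + b₃ * x₂ + n₃)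

variable [Fintype F]

/-- The region `A_J`, where `q = |F|` and `P₁, P₂, P₃` are the laws of `N₁, N₂, N₃`. -/
def regionJ (P₁ P₂ P₃ : PMF F) : Set (ℝ × ℝ) :=
  {R | 0 ≤ R.1 ∧ 0 ≤ R.2 ∧
    R.1 ≤ Real.log (Fintype.card F) - entropy P₂ ∧
    R.2 ≤ Real.log (Fintype.card F) - entropy P₁ ∧
    R.1 + R.2 ≤ Real.log (Fintype.card F) + entropy P₃ - entropy P₁ - entropy P₂}

/-- The region `A_I`, where `q = |F|` and `P₁, P₂, P₃` are the laws of `N₁, N₂, N₃`. -/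
def regionI (P₁ P₂ P₃ : PMF F) : Set (ℝ × ℝ) :=
  {R | 0 ≤ R.1 ∧ 0 ≤ R.2 ∧
    R.1 ≤ Real.log (Fintype.card F) - entropy P₂ ∧
    R.2 ≤ Real.log (Fintype.card F) - entropy P₁ ∧
    max R.1 R.2 ≤ Real.log (Fintype.card F) + entropy P₃ - entropy P₁ - entropy P₂}

end Additive

end TwoWayWiretap

end

/-! Random linear coset codes achieve both regions. User `i` encodes `kᵢ` message symbols and `lᵢ`
symbols of uniform local randomness by a uniformly chosen linear map `Gᵢ`.

Reliability: a user knows its own input word and subtracts its contribution. What remains is the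
other user's codeword, scaled by a non-zero constant, in additive noise. Message and randomness can
be decoded together as long as `(k₁ + l₁) log q` stays below `N (log q - H(N₂))` and `(k₂ + l₂) log
q` below `N (log q - H(N₁))`. By linearity the error event depends on the noise alone
(`exists_of_mlDecode_ne`), and its average over the ensemble obeys a random coding bound
(`sum_ambiguity_le`).

Secrecy: given the protected message, the eavesdropper's word is a translate of one fixed law `Q`,
the noise smeared over the linear image of all remaining randomness. So the leakage is at most the
divergence of `Q` from uniform (`mutualInfo_le_divUniform`), and on average this is small once the
randomness exceeds `N (log q - H(N₃))` nats (`sum_divUniform_smear_le`).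

Counting: with both totals filled nearly to capacity, the randomness hiding both messages has about
`N (2 log q - H(N₁) - H(N₂) - R₁ - R₂)` nats, and the resolvability threshold becomes the sum
constraint of `A_J`. For individual secrecy the other user's message also serves as randomness, so
only one rate is subtracted and the constraint of `A_I` results.

Both bounds decay exponentially in `N` because a one-letter function equal to 1 at `θ = 0` has
negative derivative there. One generator pair meets all requirements at once by averaging, and
`exists_tendsto_zero_of_forall_eventually` lets the rate slack `δ` tend to 0. -/

noncomputable section

namespace TwoWayWiretap

/-! ### Averages over linear ensembles: random coding and resolvability. -/

section Averages

variable {Ω V S W : Type*} [AddCommGroup Ω] [Fintype Ω] [AddCommGroup W] [Fintype W]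

/-- A surjective homomorphism takes every value equally often. -/
theorem card_mul_sum_comp_surjective (φ : Ω →+ W) (hφ : Function.Surjective φ) (g : W → ℝ) :
    (Fintype.card W : ℝ) * ∑ ω, g (φ ω) = Fintype.card Ω * ∑ v, g v := by
  have h : ∀ v, ∑ ω, g (φ ω + v) = ∑ ω, g (φ ω) := by
    intro v
    obtain ⟨ω₀, rfl⟩ := hφ v
    rw [← Equiv.sum_comp (Equiv.addRight ω₀) (fun ω => g (φ ω))]
    simp
  -- Double count over `v` and `ω`: translating by `v` changes nothing after summing over `ω`, and
  -- translating by `φ ω` changes nothing after summing over `v`.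
  calc (Fintype.card W : ℝ) * ∑ ω, g (φ ω) = ∑ v : W, ∑ ω, g (φ ω + v) := by simp [h]
    _ = ∑ ω, ∑ v, g (φ ω + v) := Finset.sum_comm
    _ = ∑ _ω : Ω, ∑ v, g v :=
        Finset.sum_congr rfl fun ω _ => Equiv.sum_comp (Equiv.addLeft (φ ω)) g
    _ = _ := by simp

open Classical in
/-- The probability that noise with law `p` cannot be told apart, by maximum likelihood, from the
noise that belongs to another codeword of the code `L`. -/
def ambiguity [Zero V] (p : W → ℝ) (L : V → W) : ℝ :=
  ∑ n, p n * if ∃ w, w ≠ 0 ∧ p n ≤ p (n - L w) then 1 else 0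

theorem ambiguity_nonneg [Zero V] {p : W → ℝ} (hp : ∀ n, 0 ≤ p n) (L : V → W) :
    0 ≤ ambiguity p L :=
  Finset.sum_nonneg fun n _ => mul_nonneg (hp n) (by split_ifs <;> simp)

theorem ambiguity_of_subsingleton [Zero V] [Subsingleton V] (p : W → ℝ) (L : V → W) :
    ambiguity p L = 0 := by
  refine Finset.sum_eq_zero fun n _ => ?_
  rw [if_neg, mul_zero]
  rintro ⟨w, hw, -⟩
  exact hw (Subsingleton.elim _ _)

open Classical in
/-- The random coding bound for the average of the ambiguity over a linear ensemble. -/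
theorem sum_ambiguity_le [Zero V] [Fintype V] {p : W → ℝ} (hp : ∀ n, 0 ≤ p n)
    (hp1 : ∑ n, p n = 1) (Φ : V → Ω →+ W) (hΦ : ∀ w, w ≠ 0 → Function.Surjective (Φ w))
    {θ : ℝ} (hθ : 0 ≤ θ) (hθ1 : θ ≤ 1) :
    ∑ ω, ambiguity p (fun w => Φ w ω) ≤ Fintype.card Ω *
      (((Fintype.card V : ℝ) / Fintype.card W) ^ θ * ∑ n, p n ^ (1 - θ)) := by
  have hsub : ∀ n, ∑ v, p (n - v) = 1 := fun n => by
    rw [← hp1]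
    exact Equiv.sum_comp (Equiv.subLeft n) p
  have hW : (0 : ℝ) < Fintype.card W := by exact_mod_cast Fintype.card_pos
  have hO : (0 : ℝ) < Fintype.card Ω := by exact_mod_cast Fintype.card_pos
  have hV : (0 : ℝ) < Fintype.card V := by
    exact_mod_cast Fintype.card_pos_iff.2 ⟨(0 : V)⟩
  unfold ambiguity
  rw [Finset.sum_comm, Finset.mul_sum, Finset.mul_sum]
  refine Finset.sum_le_sum fun n _ => ?_
  rw [← Finset.mul_sum]
  rcases (hp n).eq_or_lt with h0 | h0
  -- Only nonnegativity of the right side is needed, so the convention `0 ^ 0 = 1` at `θ = 1` does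
  -- no harm.
  · rw [← h0, zero_mul]
    positivity
  set x : ℝ := Fintype.card V / Fintype.card W / p n with hx
  have hx0 : 0 < x := by positivity
  have h1 : ∑ ω, (if ∃ w, w ≠ 0 ∧ p n ≤ p (n - Φ w ω) then (1 : ℝ) else 0)
      ≤ Fintype.card Ω := by
    calc _ ≤ ∑ _ω : Ω, (1 : ℝ) := Finset.sum_le_sum fun ω _ => by split_ifs <;> simp
      _ = _ := by simp
  -- Union bound over `w`, with each indicator bounded by the likelihood ratio. Since `Φ w` is
  -- surjective for `w ≠ 0`, the mean of `p (n - Φ w ω)` over `ω` is `1 / |W|`.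
  have h2 : ∑ ω, (if ∃ w, w ≠ 0 ∧ p n ≤ p (n - Φ w ω) then (1 : ℝ) else 0)
      ≤ Fintype.card Ω * x := by
    calc _ ≤ ∑ ω, ∑ w ∈ Finset.univ.filter (fun w : V => w ≠ 0), p (n - Φ w ω) / p n := by
          refine Finset.sum_le_sum fun ω _ => ?_
          have hnn : ∀ w ∈ Finset.univ.filter (fun w : V => w ≠ 0), 0 ≤ p (n - Φ w ω) / p n :=
            fun w _ => div_nonneg (hp _) h0.le
          split_ifs with h
          · obtain ⟨w, hw, hle⟩ := h
            refine le_trans ?_ (Finset.single_le_sum hnn (by simpa using hw))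
            rwa [one_le_div h0]
          · exact Finset.sum_nonneg hnn
      _ = ∑ w ∈ Finset.univ.filter (fun w : V => w ≠ 0),
            (Fintype.card Ω : ℝ) / Fintype.card W / p n := by
          rw [Finset.sum_comm]
          refine Finset.sum_congr rfl fun w hw => ?_
          have := card_mul_sum_comp_surjective (Φ w) (hΦ w (by simpa using hw))
            (fun v => p (n - v))
          rw [hsub n] at this
          rw [← Finset.sum_div]
          congr 1
          field_simp
          linarith
      _ ≤ ∑ _w : V, (Fintype.card Ω : ℝ) / Fintype.card W / p n :=
          Finset.sum_le_sum_of_subset_of_nonneg (Finset.filter_subset _ _)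
            fun _ _ _ => by positivity
      _ = _ := by
          simp only [Finset.sum_const, Finset.card_univ, nsmul_eq_mul, hx]
          field_simp
  -- Gallager's trick: `min 1 x ≤ x ^ θ` for `0 ≤ θ ≤ 1`. The factor `(p n) ^ (-θ)` inside `x ^ θ`
  -- turns the weight `p n` into `p n ^ (1 - θ)`.
  have h3 : ∑ ω, (if ∃ w, w ≠ 0 ∧ p n ≤ p (n - Φ w ω) then (1 : ℝ) else 0)
      ≤ Fintype.card Ω * x ^ θ := by
    rcases le_total x 1 with hx1 | hx1
    · refine h2.trans (mul_le_mul_of_nonneg_left ?_ hO.le)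
      simpa using Real.rpow_le_rpow_of_exponent_ge hx0 hx1 hθ1
    · refine h1.trans (le_mul_of_one_le_right hO.le (Real.one_le_rpow hx1 hθ))
  refine le_trans (le_of_eq ?_) ((mul_le_mul_of_nonneg_left h3 h0.le).trans (le_of_eq ?_))
  · congr!
  · rw [hx, Real.div_rpow (by positivity) h0.le, Real.rpow_sub h0, Real.rpow_one]
    ring

/-- The divergence of `Q` from the uniform distribution. -/
def divUniform (Q : W → ℝ) : ℝ := ∑ z, Q z * Real.log (Fintype.card W * Q z)

theorem divUniform_nonneg {Q : W → ℝ} (hQ : ∀ z, 0 ≤ Q z) (hQ1 : ∑ z, Q z = 1) :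
    0 ≤ divUniform Q := by
  have hW : (0 : ℝ) < Fintype.card W := by exact_mod_cast Fintype.card_pos
  calc (0 : ℝ) = ∑ z, (Q z - (Fintype.card W : ℝ)⁻¹) := by
        rw [Finset.sum_sub_distrib, hQ1]
        simp [hW.ne']
    _ ≤ _ := by
        refine Finset.sum_le_sum fun z _ => ?_
        rcases (hQ z).eq_or_lt with h0 | h0
        · rw [← h0]
          simp
        · have h1 : 0 < Fintype.card W * Q z := by positivity
          have := mul_le_mul_of_nonneg_left (Real.one_sub_inv_le_log_of_pos h1) h0.le
          refine le_trans (le_of_eq ?_) this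
          field_simp

/-- The law of `L s + n`, where `s` is uniform and `n` has the law `p`. -/
def smear {W : Type*} [AddCommGroup W] [Fintype S] (p : W → ℝ) (L : S → W) (z : W) : ℝ :=
  (Fintype.card S : ℝ)⁻¹ * ∑ s, p (z - L s)

theorem smear_nonneg {W : Type*} [AddCommGroup W] [Fintype S] {p : W → ℝ} (hp : ∀ n, 0 ≤ p n) (L : S → W) (z : W) :
    0 ≤ smear p L z :=
  mul_nonneg (by positivity) (Finset.sum_nonneg fun _ _ => hp _)

theorem sum_smear [Fintype S] [Nonempty S] {p : W → ℝ} (hp1 : ∑ n, p n = 1) (L : S → W) :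
    ∑ z, smear p L z = 1 := by
  unfold smear
  rw [← Finset.mul_sum, Finset.sum_comm]
  have : ∀ s, ∑ z, p (z - L s) = 1 := fun s => by
    rw [← hp1]
    exact Equiv.sum_comp (Equiv.subRight (L s)) p
  simp [this]

/-- The smeared law is invariant under translation by the image of `L`. In the expectation over `z =
n + L s` the logarithm therefore depends on `n` only, and the average over `s` disappears. -/
theorem divUniform_smear [AddCommGroup S] [Fintype S] (p : W → ℝ) (L : S →+ W) :
    divUniform (smear p L) = ∑ n, p n * Real.log (Fintype.card W * smear p L n) := by
  have hinv : ∀ s n, smear p L (n + L s) = smear p L n := by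
    intro s n
    unfold smear
    rw [← Equiv.sum_comp (Equiv.addRight s) (fun s' => p (n + L s - L s'))]
    simp
  have hS : (Fintype.card S : ℝ) ≠ 0 := by exact_mod_cast Fintype.card_ne_zero
  calc divUniform (smear p L)
      = ∑ z, (Fintype.card S : ℝ)⁻¹ *
          ∑ s, p (z - L s) * Real.log (Fintype.card W * smear p L z) := by
        unfold divUniform
        refine Finset.sum_congr rfl fun z _ => ?_
        rw [← Finset.sum_mul, ← mul_assoc]
        rfl
    _ = (Fintype.card S : ℝ)⁻¹ *
          ∑ s, ∑ z, p (z - L s) * Real.log (Fintype.card W * smear p L z) := by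
        rw [← Finset.mul_sum, Finset.sum_comm]
    _ = (Fintype.card S : ℝ)⁻¹ *
          ∑ _s : S, ∑ n, p n * Real.log (Fintype.card W * smear p L n) := by
        congr 1
        refine Finset.sum_congr rfl fun s _ => ?_
        rw [← Equiv.sum_comp (Equiv.addRight (L s))]
        simp [hinv]
    _ = _ := by
        simp [hS]

/-- Apply the logarithm to `(1 + x) ^ θ ≤ 1 + x ^ θ`, then `log (1 + y) ≤ y`. -/
theorem log_one_add_le_rpow_div {x θ : ℝ} (hx : 0 ≤ x) (hθ : 0 < θ) (hθ1 : θ ≤ 1) :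
    Real.log (1 + x) ≤ x ^ θ / θ := by
  have h1 : (1 + x) ^ θ ≤ 1 + x ^ θ := by
    simpa using Real.rpow_add_le_add_rpow zero_le_one hx hθ.le hθ1
  rw [le_div_iff₀ hθ, mul_comm, ← Real.log_rpow (by positivity)]
  have h2 := Real.log_le_log (by positivity) h1
  have h3 := Real.log_le_sub_one_of_pos (show 0 < 1 + x ^ θ by positivity)
  linarith

/-- The resolvability bound for the average of the divergence over a linear ensemble. -/
theorem sum_divUniform_smear_le [AddCommGroup S] [Fintype S] {p : W → ℝ} (hp : ∀ n, 0 ≤ p n)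
    (hp1 : ∑ n, p n = 1) (L : Ω → S →+ W) (Φ : S → Ω →+ W) (hL : ∀ ω s, L ω s = Φ s ω)
    (hΦ : ∀ s, s ≠ 0 → Function.Surjective (Φ s)) {θ : ℝ} (hθ : 0 < θ) (hθ1 : θ ≤ 1) :
    ∑ ω, divUniform (smear p (L ω)) ≤ Fintype.card Ω *
      (((Fintype.card W : ℝ) / Fintype.card S) ^ θ * (∑ n, p n ^ (1 + θ)) / θ) := by
  classical
  have hsub : ∀ n, ∑ v, p (n - v) = 1 := fun n => by
    rw [← hp1]
    exact Equiv.sum_comp (Equiv.subLeft n) p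
  have hW : (0 : ℝ) < Fintype.card W := by exact_mod_cast Fintype.card_pos
  have hO : (0 : ℝ) < Fintype.card Ω := by exact_mod_cast Fintype.card_pos
  have hS : (0 : ℝ) < Fintype.card S := by exact_mod_cast Fintype.card_pos
  simp only [divUniform_smear]
  rw [Finset.sum_comm, mul_div_assoc, Finset.sum_div, Finset.mul_sum, Finset.mul_sum]
  refine Finset.sum_le_sum fun n _ => ?_
  rw [← Finset.mul_sum]
  rcases (hp n).eq_or_lt with h0 | h0
  · rw [← h0, zero_mul]
    positivity
  set x : ℝ := Fintype.card W / Fintype.card S * p n with hx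
  have hx0 : 0 < x := by positivity
  -- The term `s = 0` gives `p n` for every `ω` and accounts for `x`. Each `s ≠ 0` averages to `1 /
  -- |W|`, and together they account for at most 1.
  have hmean : ∑ ω, Fintype.card W * smear p (L ω) n ≤ Fintype.card Ω * (1 + x) := by
    calc ∑ ω, Fintype.card W * smear p (L ω) n
        = (Fintype.card W / Fintype.card S) * ∑ s, ∑ ω, p (n - Φ s ω) := by
          rw [Finset.sum_comm, Finset.mul_sum]
          refine Finset.sum_congr rfl fun ω _ => ?_
          simp only [smear, hL]
          ring
      _ = (Fintype.card W / Fintype.card S) * (∑ ω : Ω, p n +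
            ∑ s ∈ Finset.univ.erase (0 : S), ∑ ω, p (n - Φ s ω)) := by
          rw [← Finset.add_sum_erase _ _ (Finset.mem_univ (0 : S))]
          simp only [← hL, map_zero, sub_zero]
      _ = (Fintype.card W / Fintype.card S) * (∑ ω : Ω, p n +
            ∑ s ∈ Finset.univ.erase (0 : S), (Fintype.card Ω : ℝ) / Fintype.card W) := by
          congr 2
          refine Finset.sum_congr rfl fun s hs => ?_
          have := card_mul_sum_comp_surjective (Φ s) (hΦ s (by simpa using hs))
            (fun v => p (n - v))
          rw [hsub n] at this
          rw [eq_div_iff hW.ne']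
          linarith
      _ ≤ (Fintype.card W / Fintype.card S) * (∑ ω : Ω, p n +
            ∑ s : S, (Fintype.card Ω : ℝ) / Fintype.card W) := by
          gcongr
          exact Finset.subset_univ _
      _ = _ := by
          simp only [Finset.sum_const, Finset.card_univ, nsmul_eq_mul, hx]
          field_simp
          ring
  -- Jensen's inequality for the logarithm, by way of its tangent at `1 + x`.
  have hlog : ∑ ω, Real.log (Fintype.card W * smear p (L ω) n)
      ≤ Fintype.card Ω * Real.log (1 + x) := by
    have hterm : ∀ ω, Real.log (Fintype.card W * smear p (L ω) n)
        ≤ Real.log (1 + x) + (Fintype.card W * smear p (L ω) n / (1 + x) - 1) := by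
      intro ω
      have hpos : 0 < smear p (L ω) n := by
        refine mul_pos (by positivity) (Finset.sum_pos' (fun _ _ => hp _) ⟨0, Finset.mem_univ _, ?_⟩)
        simpa using h0
      have h1 : 0 < Fintype.card W * smear p (L ω) n := by positivity
      have := Real.log_le_sub_one_of_pos (show 0 < Fintype.card W * smear p (L ω) n / (1 + x) by
        positivity)
      rw [Real.log_div h1.ne' (by positivity)] at this
      linarith
    refine (Finset.sum_le_sum fun ω _ => hterm ω).trans ?_
    rw [Finset.sum_add_distrib, Finset.sum_sub_distrib, ← Finset.sum_div]
    have : (∑ ω, Fintype.card W * smear p (L ω) n) / (1 + x) ≤ Fintype.card Ω := by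
      rwa [div_le_iff₀ (by positivity)]
    simp only [Finset.sum_const, Finset.card_univ, nsmul_eq_mul]
    linarith
  calc _ ≤ p n * (Fintype.card Ω * (x ^ θ / θ)) := by
        refine mul_le_mul_of_nonneg_left (hlog.trans ?_) h0.le
        exact mul_le_mul_of_nonneg_left (log_one_add_le_rpow_div hx0.le hθ hθ1) hO.le
    _ = _ := by
      rw [hx, Real.mul_rpow (by positivity) h0.le, Real.rpow_add h0, Real.rpow_one]
      ring

end Averages

/-! ### Mutual information and divergence from the uniform law. -/

section MutualInfo

variable {A B W : Type*} [Fintype A] [Fintype B]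

theorem toReal_map_fst (P : PMF (A × B)) (a : A) :
    ((P.map Prod.fst) a).toReal = ∑ b, (P (a, b)).toReal := by
  classical
  rw [PMF.map_apply, tsum_fintype, Fintype.sum_prod_type,
    ← ENNReal.toReal_sum fun b _ => P.apply_ne_top _]
  congr 1
  rw [Finset.sum_comm]
  simp

theorem toReal_map_snd (P : PMF (A × B)) (b : B) :
    ((P.map Prod.snd) b).toReal = ∑ a, (P (a, b)).toReal := by
  classical
  rw [PMF.map_apply, tsum_fintype, Fintype.sum_prod_type,
    ← ENNReal.toReal_sum fun b _ => P.apply_ne_top _]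
  congr 1
  simp

theorem sum_toReal (P : PMF A) : ∑ a, (P a).toReal = 1 := by
  rw [← ENNReal.toReal_sum fun b _ => P.apply_ne_top _, ← tsum_fintype (L := .unconditional A),
    P.tsum_coe, ENNReal.toReal_one]

/-- Serves the codes without message symbols, for which the resolvability bound may be out of reach.
-/
theorem mutualInfo_of_subsingleton [Subsingleton A] (P : PMF (A × B)) : mutualInfo P = 0 := by
  refine Finset.sum_eq_zero fun a _ => Finset.sum_eq_zero fun b _ => ?_
  have hA : (Finset.univ : Finset A) = {a} :=
    Finset.eq_singleton_iff_unique_mem.2 ⟨Finset.mem_univ _, fun _ _ => Subsingleton.elim _ _⟩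
  have h1 : ((P.map Prod.fst) a).toReal = 1 := by
    have := sum_toReal (P.map Prod.fst)
    rwa [hA, Finset.sum_singleton] at this
  have h2 : ((P.map Prod.snd) b).toReal = (P (a, b)).toReal := by
    rw [toReal_map_snd, hA, Finset.sum_singleton]
  rw [h1, h2, one_mul]
  rcases eq_or_ne (P (a, b)).toReal 0 with h | h
  · simp [h]
  · simp [div_self h]

/-- If the observation, given a uniform message, is a translate of a fixed law `Q`, then the
leakage is at most the divergence of `Q` from the uniform distribution. -/
theorem mutualInfo_le_divUniform [Nonempty A] [AddCommGroup W] [Fintype W] (P : PMF (A × W))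
    (c : A → W) {Q : W → ℝ} (hQ : ∀ z, 0 ≤ Q z) (hQ1 : ∑ z, Q z = 1)
    (hP : ∀ a z, (P (a, z)).toReal = (Fintype.card A : ℝ)⁻¹ * Q (z - c a)) :
    mutualInfo P ≤ divUniform Q := by
  have hA : (0 : ℝ) < Fintype.card A := by exact_mod_cast Fintype.card_pos
  have hW : (0 : ℝ) < Fintype.card W := by exact_mod_cast Fintype.card_pos
  have hshift : ∀ (g : W → ℝ) a, ∑ z, g (z - c a) = ∑ z, g z := fun g a =>
    Equiv.sum_comp (Equiv.subRight (c a)) g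
  have hfst : ∀ a, ((P.map Prod.fst) a).toReal = (Fintype.card A : ℝ)⁻¹ := fun a => by
    rw [toReal_map_fst]
    simp only [hP]
    rw [← Finset.mul_sum, hshift, hQ1, mul_one]
  set R : W → ℝ := fun z => ((P.map Prod.snd) z).toReal with hR
  have hRsum : ∀ z, R z = ∑ a, (Fintype.card A : ℝ)⁻¹ * Q (z - c a) := fun z => by
    simp only [hR, toReal_map_snd, hP]
  have hR0 : 0 ≤ divUniform R :=
    divUniform_nonneg (fun z => ENNReal.toReal_nonneg) (sum_toReal _)
  have hterm : ∀ a z, (P (a, z)).toReal * Real.log ((P (a, z)).toReal /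
      (((P.map Prod.fst) a).toReal * ((P.map Prod.snd) z).toReal)) =
      (Fintype.card A : ℝ)⁻¹ *
        (Q (z - c a) * Real.log (Fintype.card W * Q (z - c a))) -
      (Fintype.card A : ℝ)⁻¹ * Q (z - c a) * Real.log (Fintype.card W * R z) := by
    intro a z
    rw [hP, hfst]
    change _ * Real.log (_ / (_ * R z)) = _
    rcases (hQ (z - c a)).eq_or_lt with h0 | h0
    · simp [← h0]
    · have hRpos : 0 < R z := by
        rw [hRsum]
        exact Finset.sum_pos' (fun _ _ => mul_nonneg (by positivity) (hQ _))
          ⟨a, Finset.mem_univ _, by positivity⟩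
      have : (Fintype.card A : ℝ)⁻¹ * Q (z - c a) / ((Fintype.card A : ℝ)⁻¹ * R z) =
          (Fintype.card W * Q (z - c a)) / (Fintype.card W * R z) := by
        field_simp
      rw [this, Real.log_div (by positivity) (by positivity)]
      ring
  -- The leakage is exactly a difference of divergences; the one of the output law `R` is
  -- nonnegative and is dropped.
  have : mutualInfo P = divUniform Q - divUniform R := by
    unfold mutualInfo
    simp only [hterm, Finset.sum_sub_distrib]
    congr 1
    · simp only [← Finset.mul_sum]
      have h2 : ∀ a, ∑ z, Q (z - c a) * Real.log (Fintype.card W * Q (z - c a)) = divUniform Q :=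
        hshift fun z => Q z * Real.log (Fintype.card W * Q z)
      simp [h2, hA.ne']
    · rw [Finset.sum_comm]
      refine Finset.sum_congr rfl fun z _ => ?_
      rw [← Finset.sum_mul, ← hRsum]
  linarith

end MutualInfo

/-! ### One-letter exponents and their derivative at zero. -/

section SingleLetter

variable {F : Type*} [Fintype F]

/-- The function equals 1 at `θ = 0`, so the sign of `c - entropy P` decides on which side of 0 it
drops below 1. The right side yields resolvability, the left side reliability. -/
theorem hasDerivAt_sum_rpow (P : PMF F) (c : ℝ) :
    HasDerivAt (fun θ : ℝ => Real.exp (θ * c) * ∑ a, (P a).toReal ^ (1 + θ))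
      (c - entropy P) 0 := by
  have h1 : ∀ a, HasDerivAt (fun θ : ℝ => (P a).toReal ^ (1 + θ))
      ((P a).toReal * Real.log (P a).toReal) 0 := by
    intro a
    rcases (ENNReal.toReal_nonneg (a := P a)).eq_or_lt with h0 | h0
    · rw [← h0, zero_mul]
      -- For a letter of probability 0 the power `0 ^ (1 + θ)` is 0 only where `1 + θ ≠ 0`, hence
      -- the restriction to a neighbourhood of 0.
      refine (hasDerivAt_const (0 : ℝ) (0 : ℝ)).congr_of_eventuallyEq ?_
      filter_upwards [lt_mem_nhds (show (-1 : ℝ) < 0 by norm_num)] with θ hθ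
      exact Real.zero_rpow (by linarith)
    · have h2 : HasDerivAt (fun θ : ℝ => 1 + θ) 1 0 := (hasDerivAt_id (0 : ℝ)).const_add 1
      have := h2.const_rpow h0
      simpa [mul_comm] using this
  have h3 : HasDerivAt (fun θ : ℝ => Real.exp (θ * c)) c 0 := by
    simpa using ((hasDerivAt_id (0 : ℝ)).mul_const c).exp
  have h4 := h3.fun_mul (HasDerivAt.fun_sum (u := Finset.univ) fun a _ => h1 a)
  refine h4.congr_deriv ?_
  simp [entropy, sum_toReal, sub_eq_add_neg]

theorem exists_lt_of_hasDerivAt_neg {f : ℝ → ℝ} {d : ℝ} (hf : HasDerivAt f d 0) (hd : d < 0) :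
    ∃ θ : ℝ, 0 < θ ∧ θ ≤ 1 ∧ f θ < f 0 := by
  have h1 : Tendsto (slope f 0) (𝓝[>] 0) (𝓝 d) :=
    (hasDerivAt_iff_tendsto_slope.1 hf).mono_left
      (nhdsWithin_mono (0 : ℝ) fun x (hx : 0 < x) => ne_of_gt hx)
  have h2 := (h1.eventually (gt_mem_nhds hd)).and
    (Ioc_mem_nhdsGT (show (0 : ℝ) < 1 by norm_num))
  obtain ⟨θ, hs, h0, hθ1⟩ := h2.exists
  refine ⟨θ, h0, hθ1, ?_⟩
  rw [slope_def_field, sub_zero, div_neg_iff] at hs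
  rcases hs with h | h
  · linarith [h.2]
  · linarith [h.1]

theorem exists_exp_mul_sum_rpow_lt_one (P : PMF F) {c : ℝ} (hc : c < entropy P) :
    ∃ θ : ℝ, 0 < θ ∧ θ ≤ 1 ∧ Real.exp (θ * c) * ∑ a, (P a).toReal ^ (1 + θ) < 1 := by
  have := exists_lt_of_hasDerivAt_neg (hasDerivAt_sum_rpow P c) (sub_neg.2 hc)
  simpa [sum_toReal] using this

theorem exists_exp_neg_mul_sum_rpow_lt_one (P : PMF F) {c : ℝ} (hc : entropy P < c) :
    ∃ θ : ℝ, 0 < θ ∧ θ ≤ 1 ∧ Real.exp (-(θ * c)) * ∑ a, (P a).toReal ^ (1 - θ) < 1 := by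
  have h1 := hasDerivAt_sum_rpow P c
  -- The base point is written as `-0` so that the chain rule with `θ ↦ -θ` applies.
  rw [← neg_zero] at h1
  have h2 := h1.scomp (0 : ℝ) (hasDerivAt_neg (0 : ℝ))
  have := exists_lt_of_hasDerivAt_neg h2 (by simpa using hc)
  simpa [sum_toReal, sub_eq_add_neg] using this

end SingleLetter

/-! ### Product laws of memoryless noise. -/

section Product

theorem piPMF_apply {A : Type*} [Fintype A] {n : ℕ} (P : Fin n → PMF A) (w : Fin n → A) :
    piPMF P w = ∏ i, P i (w i) := rfl

theorem piPMF_map {A B : Type*} [Fintype A] [Fintype B] {n : ℕ} (P : Fin n → PMF A)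
    (f : Fin n → A → B) :
    (piPMF P).map (fun w i => f i (w i)) = piPMF fun i => (P i).map (f i) := by
  classical
  ext z
  rw [PMF.map_apply, tsum_fintype, piPMF_apply]
  simp only [PMF.map_apply, tsum_fintype]
  rw [Finset.prod_univ_sum, Fintype.piFinset_univ]
  refine Finset.sum_congr rfl fun w _ => ?_
  split_ifs with h
  · subst h
    simp [piPMF_apply]
  · obtain ⟨i, hi⟩ := Function.ne_iff.1 h
    exact (Finset.prod_eq_zero (Finset.mem_univ i) (if_neg hi)).symm

variable {F : Type*} [Fintype F]

/-- The probability mass function of `N` independent noise letters. -/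
def noiseLaw (P : PMF F) (N : ℕ) (n : Fin N → F) : ℝ := (piPMF (fun _ => P) n).toReal

theorem noiseLaw_eq_prod (P : PMF F) (N : ℕ) (n : Fin N → F) :
    noiseLaw P N n = ∏ i, (P (n i)).toReal := by
  rw [noiseLaw, piPMF_apply, ENNReal.toReal_prod]

theorem noiseLaw_nonneg (P : PMF F) (N : ℕ) (n : Fin N → F) : 0 ≤ noiseLaw P N n :=
  ENNReal.toReal_nonneg

theorem sum_noiseLaw (P : PMF F) (N : ℕ) : ∑ n, noiseLaw P N n = 1 := sum_toReal _

/-- Tensorization: a one-letter factor below 1 becomes exponential decay in the block length. -/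
theorem sum_noiseLaw_rpow (P : PMF F) (N : ℕ) (s : ℝ) :
    ∑ n, noiseLaw P N n ^ s = (∑ a, (P a).toReal ^ s) ^ N := by
  classical
  rw [Fintype.sum_pow]
  refine Finset.sum_congr rfl fun n _ => ?_
  rw [noiseLaw_eq_prod, Real.finsetProd_rpow _ _ fun i _ => ENNReal.toReal_nonneg]

theorem toOuterMeasure_bind_le {A B : Type*} (p : PMF A) (f : A → PMF B) (s : Set B) {c : ℝ≥0∞}
    (h : ∀ a ∈ p.support, (f a).toOuterMeasure s ≤ c) : (p.bind f).toOuterMeasure s ≤ c := by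
  rw [PMF.toOuterMeasure_bind_apply]
  calc ∑' a, p a * (f a).toOuterMeasure s ≤ ∑' a, p a * c := by
        refine ENNReal.tsum_le_tsum fun a => ?_
        by_cases ha : p a = 0
        · simp [ha]
        · gcongr
          exact h a ((p.mem_support_iff a).2 ha)
    _ = c := by rw [ENNReal.tsum_mul_right, p.tsum_coe, one_mul]

theorem toOuterMeasure_ne_top {A : Type*} (p : PMF A) (s : Set A) :
    p.toOuterMeasure s ≠ ⊤ := by
  refine ne_top_of_le_ne_top ENNReal.one_ne_top ?_
  rw [PMF.toOuterMeasure_apply, ← p.tsum_coe]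
  exact ENNReal.tsum_le_tsum fun a => Set.indicator_le_self _ _ a

end Product

/-! ### Maximum likelihood decoding of a linear code. -/

section Decoder

variable {V W : Type*} [AddCommGroup V] [Fintype V] [AddCommGroup W]

/-- Maximum likelihood decoding of the code `L` under additive noise with law `p`. -/
def mlDecode (p : W → ℝ) (L : V → W) (y : W) : V :=
  Classical.choose (Finite.exists_max fun v => p (y - L v))

theorem le_mlDecode (p : W → ℝ) (L : V → W) (y : W) (v : V) :
    p (y - L v) ≤ p (y - L (mlDecode p L y)) :=
  Classical.choose_spec (Finite.exists_max fun v => p (y - L v)) v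

/-- By linearity the difference `w` of decoded and sent vector explains the error whatever was sent.
The inequality is not strict, so ties count as errors and the arbitrary choice of maximizer is
irrelevant. -/
theorem exists_of_mlDecode_ne (p : W → ℝ) (L : V →+ W) {v : V} {n : W}
    (h : mlDecode p L (L v + n) ≠ v) : ∃ w, w ≠ 0 ∧ p n ≤ p (n - L w) := by
  refine ⟨mlDecode p L (L v + n) - v, sub_ne_zero.2 h, ?_⟩
  have := le_mlDecode p L (L v + n) v
  rw [map_sub]
  convert this using 2 <;> abel

end Decoder

/-! ### Coset codes: error probability and law of the eavesdropper's word. -/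

section LinearCode

variable {F : Type*} [Field F] [Fintype F]

theorem memoryless_map {Y₁ Y₂ Z : Type*} [Fintype Y₁] [Fintype Y₂] [Fintype Z]
    (W : Channel F F Y₁ Y₂ Z) (π : Y₁ × Y₂ × Z → F) (a b : F) (P : PMF F)
    (h : ∀ x₁ x₂, (W x₁ x₂).map π = P.map fun n => a * x₁ + b * x₂ + n) {N : ℕ}
    (x₁ x₂ : Fin N → F) :
    (W.memoryless x₁ x₂).map (fun w i => π (w i)) =
      (piPMF fun _ => P).map fun n => a • x₁ + b • x₂ + n := by
  unfold Channel.memoryless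
  rw [piPMF_map _ fun _ => π]
  simp only [h]
  rw [← piPMF_map (fun _ => P) fun i n => a * x₁ i + b * x₂ i + n]
  rfl

theorem additiveChannel_map_fst {K : Type*} [Field K] (a₁ b₁ a₂ b₂ a₃ b₃ : K)
    (P₁ P₂ P₃ : PMF K) (x₁ x₂ : K) :
    (additiveChannel a₁ b₁ a₂ b₂ a₃ b₃ P₁ P₂ P₃ x₁ x₂).map (fun y => y.1) =
      P₁.map fun n => a₁ * x₁ + b₁ * x₂ + n := by
  simp only [additiveChannel, PMF.map_bind, PMF.map_comp, Function.comp_def]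
  simp only [PMF.bind_const, PMF.map, Function.comp_def]

theorem additiveChannel_map_snd_fst {K : Type*} [Field K] (a₁ b₁ a₂ b₂ a₃ b₃ : K)
    (P₁ P₂ P₃ : PMF K) (x₁ x₂ : K) :
    (additiveChannel a₁ b₁ a₂ b₂ a₃ b₃ P₁ P₂ P₃ x₁ x₂).map (fun y => y.2.1) =
      P₂.map fun n => a₂ * x₁ + b₂ * x₂ + n := by
  simp only [additiveChannel, PMF.map_bind, PMF.map_comp, Function.comp_def]
  simp only [PMF.bind_const, PMF.map, Function.comp_def]

theorem additiveChannel_map_snd_snd {K : Type*} [Field K] (a₁ b₁ a₂ b₂ a₃ b₃ : K)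
    (P₁ P₂ P₃ : PMF K) (x₁ x₂ : K) :
    (additiveChannel a₁ b₁ a₂ b₂ a₃ b₃ P₁ P₂ P₃ x₁ x₂).map (fun y => y.2.2) =
      P₃.map fun n => a₃ * x₁ + b₃ * x₂ + n := by
  simp only [additiveChannel, PMF.map_bind, PMF.map_comp, Function.comp_def]
  simp only [PMF.bind_const]

variable {M₁ M₂ S₁ S₂ : Type*} [AddCommGroup M₁] [AddCommGroup M₂] [AddCommGroup S₁]
  [AddCommGroup S₂] [Module F M₁] [Module F M₂] [Module F S₁] [Module F S₂]
  [Fintype M₁] [Fintype M₂] [Fintype S₁] [Fintype S₂] {N : ℕ}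

/-- The coset code in which User `i` sends `Gᵢ (mᵢ, sᵢ)`, where `mᵢ` is the message and `sᵢ` is
local randomness. -/
def linearCode (a₁ b₁ a₂ b₂ : F) (P₁ P₂ : PMF F)
    (G₁ : M₁ × S₁ →ₗ[F] (Fin N → F)) (G₂ : M₂ × S₂ →ₗ[F] (Fin N → F)) :
    NonadaptiveCode F F F F N where
  L₁ := Fintype.card M₁
  L₂ := Fintype.card M₂
  neZero₁ := ⟨Fintype.card_ne_zero⟩
  neZero₂ := ⟨Fintype.card_ne_zero⟩
  enc₁ m := (PMF.uniformOfFintype S₁).map fun s => G₁ ((Fintype.equivFin M₁).symm m, s)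
  enc₂ m := (PMF.uniformOfFintype S₂).map fun s => G₂ ((Fintype.equivFin M₂).symm m, s)
  dec₁ x y := Fintype.equivFin M₂ (mlDecode (noiseLaw P₁ N) (b₁ • G₂) (y - a₁ • x)).1
  dec₂ x y := Fintype.equivFin M₁ (mlDecode (noiseLaw P₂ N) (a₂ • G₁) (y - b₂ • x)).1

theorem ambiguity_eq_toReal {V : Type*} [AddCommGroup V] (P : PMF F) (L : V → (Fin N → F)) :
    ambiguity (noiseLaw P N) L = ((piPMF fun _ => P).toOuterMeasure
      {n | ∃ w, w ≠ 0 ∧ noiseLaw P N n ≤ noiseLaw P N (n - L w)}).toReal := by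
  classical
  rw [PMF.toOuterMeasure_apply, tsum_fintype, ENNReal.toReal_sum]
  · refine Finset.sum_congr rfl fun n _ => ?_
    by_cases h : ∃ w, w ≠ 0 ∧ noiseLaw P N n ≤ noiseLaw P N (n - L w)
    · rw [if_pos h, Set.indicator_of_mem (by exact h), mul_one]
      rfl
    · rw [if_neg h, Set.indicator_of_notMem (by exact h), mul_zero, ENNReal.toReal_zero]
  · intro n _
    exact ne_top_of_le_ne_top ((piPMF fun _ => P).apply_ne_top n) (Set.indicator_le_self _ _ n)

/-- A union bound over the two users. Each cancels its own input, and the bound holds for every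
message pair and every value of the local randomness, so averaging is free. Decoding message and
randomness jointly is stricter than needed but makes the ambiguity one of the full linear code. -/
theorem errorProb_linearCode_le (a₁ b₁ a₂ b₂ a₃ b₃ : F) (P₁ P₂ P₃ : PMF F)
    (G₁ : M₁ × S₁ →ₗ[F] (Fin N → F)) (G₂ : M₂ × S₂ →ₗ[F] (Fin N → F)) :
    (linearCode a₁ b₁ a₂ b₂ P₁ P₂ G₁ G₂).errorProb
      (additiveChannel a₁ b₁ a₂ b₂ a₃ b₃ P₁ P₂ P₃) ≤
    ambiguity (noiseLaw P₂ N) (a₂ • G₁) + ambiguity (noiseLaw P₁ N) (b₁ • G₂) := by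
  set C := linearCode a₁ b₁ a₂ b₂ P₁ P₂ G₁ G₂ with hC
  set W := additiveChannel a₁ b₁ a₂ b₂ a₃ b₃ P₁ P₂ P₃ with hW
  set B := ambiguity (noiseLaw P₂ N) (a₂ • G₁) + ambiguity (noiseLaw P₁ N) (b₁ • G₂) with hB
  have key : ∀ m₁ m₂, ((C.condLaw W m₁ m₂).toOuterMeasure
      {ω | C.dec₂ ω.2.1 (fun i => (ω.2.2 i).2.1) ≠ m₁ ∨
        C.dec₁ ω.1 (fun i => (ω.2.2 i).1) ≠ m₂}).toReal ≤ B := by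
    intro m₁ m₂
    rw [hB, ambiguity_eq_toReal, ambiguity_eq_toReal,
      ← ENNReal.toReal_add (toOuterMeasure_ne_top _ _) (toOuterMeasure_ne_top _ _)]
    refine ENNReal.toReal_mono
      (ENNReal.add_ne_top.2 ⟨toOuterMeasure_ne_top _ _, toOuterMeasure_ne_top _ _⟩) ?_
    refine toOuterMeasure_bind_le _ _ _ fun x₁ hx₁ => toOuterMeasure_bind_le _ _ _ fun x₂ hx₂ => ?_
    obtain ⟨s₁, -, rfl⟩ := (PMF.mem_support_map_iff _ _ _).1 hx₁
    obtain ⟨s₂, -, rfl⟩ := (PMF.mem_support_map_iff _ _ _).1 hx₂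
    set x₁ := G₁ ((Fintype.equivFin M₁).symm m₁, s₁) with hx₁'
    set x₂ := G₂ ((Fintype.equivFin M₂).symm m₂, s₂) with hx₂'
    rw [PMF.toOuterMeasure_map_apply]
    have h2 : (W.memoryless x₁ x₂).toOuterMeasure
        ((fun w i => (w i).2.1) ⁻¹' {y | C.dec₂ x₂ y ≠ m₁}) ≤
        (piPMF fun _ => P₂).toOuterMeasure
        {n | ∃ w, w ≠ 0 ∧ noiseLaw P₂ N n ≤ noiseLaw P₂ N (n - (a₂ • G₁) w)} := by
      rw [← PMF.toOuterMeasure_map_apply,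
        memoryless_map W (fun y => y.2.1) a₂ b₂ P₂ (additiveChannel_map_snd_fst _ _ _ _ _ _ _ _ _),
        PMF.toOuterMeasure_map_apply]
      refine MeasureTheory.measure_mono fun n hn => ?_
      refine exists_of_mlDecode_ne (noiseLaw P₂ N) (a₂ • G₁).toAddMonoidHom
        (v := ((Fintype.equivFin M₁).symm m₁, s₁)) fun h => hn ?_
      refine (Equiv.eq_symm_apply _).1 ?_
      change (mlDecode (noiseLaw P₂ N) (a₂ • G₁) (a₂ • x₁ + b₂ • x₂ + n - b₂ • x₂)).1 = _
      have e : a₂ • x₁ + b₂ • x₂ + n - b₂ • x₂ = a₂ • x₁ + n := by abel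
      rw [e]
      exact congrArg Prod.fst h
    have h1 : (W.memoryless x₁ x₂).toOuterMeasure
        ((fun w i => (w i).1) ⁻¹' {y | C.dec₁ x₁ y ≠ m₂}) ≤
        (piPMF fun _ => P₁).toOuterMeasure
        {n | ∃ w, w ≠ 0 ∧ noiseLaw P₁ N n ≤ noiseLaw P₁ N (n - (b₁ • G₂) w)} := by
      rw [← PMF.toOuterMeasure_map_apply,
        memoryless_map W (fun y => y.1) a₁ b₁ P₁ (additiveChannel_map_fst _ _ _ _ _ _ _ _ _),
        PMF.toOuterMeasure_map_apply]
      refine MeasureTheory.measure_mono fun n hn => ?_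
      refine exists_of_mlDecode_ne (noiseLaw P₁ N) (b₁ • G₂).toAddMonoidHom
        (v := ((Fintype.equivFin M₂).symm m₂, s₂)) fun h => hn ?_
      refine (Equiv.eq_symm_apply _).1 ?_
      change (mlDecode (noiseLaw P₁ N) (b₁ • G₂) (a₁ • x₁ + b₁ • x₂ + n - a₁ • x₁)).1 = _
      have e : a₁ • x₁ + b₁ • x₂ + n - a₁ • x₁ = b₁ • x₂ + n := by abel
      rw [e]
      exact congrArg Prod.fst h
    exact (MeasureTheory.measure_union_le _ _).trans (add_le_add h2 h1)
  have h1 : (0 : ℝ) < C.L₁ := by exact_mod_cast NeZero.pos C.L₁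
  have h2 : (0 : ℝ) < C.L₂ := by exact_mod_cast NeZero.pos C.L₂
  unfold NonadaptiveCode.errorProb
  rw [one_div, inv_mul_le_iff₀ (by positivity)]
  refine (Finset.sum_le_sum fun m₁ _ => Finset.sum_le_sum fun m₂ _ => key m₁ m₂).trans ?_
  simp [mul_assoc]

theorem messageEveLaw_apply {X₁ X₂ Y₁ Y₂ Z : Type*} [Fintype Y₁] [Fintype Y₂] [Fintype Z]
    (C : NonadaptiveCode X₁ X₂ Y₁ Y₂ N) (W : Channel X₁ X₂ Y₁ Y₂ Z) (m₁ : Fin C.L₁)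
    (m₂ : Fin C.L₂) (z : Fin N → Z) :
    C.messageEveLaw W ((m₁, m₂), z) = (C.L₁ : ℝ≥0∞)⁻¹ * ((C.L₂ : ℝ≥0∞)⁻¹ *
      ((C.condLaw W m₁ m₂).map fun ω i => (ω.2.2 i).2.2) z) := by
  classical
  have h : ∀ k₁ k₂, ((C.condLaw W k₁ k₂).map fun ω => ((k₁, k₂), fun i => (ω.2.2 i).2.2))
      ((m₁, m₂), z) = if m₁ = k₁ ∧ m₂ = k₂ then
        ((C.condLaw W k₁ k₂).map fun ω i => (ω.2.2 i).2.2) z else 0 := by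
    intro k₁ k₂
    simp only [PMF.map_apply, Prod.mk.injEq]
    split_ifs with hk
    · simp only [hk, and_self, true_and]
      refine tsum_congr fun _ => ?_
      congr
    · simp [hk]
  unfold NonadaptiveCode.messageEveLaw
  simp only [PMF.bind_apply, h, tsum_fintype, PMF.uniformOfFintype_apply, Fintype.card_fin]
  rw [Finset.sum_eq_single m₁, Finset.sum_eq_single m₂]
  · simp
  · intro k _ hk
    simp [hk.symm]
  · simp
  · intro k _ hk
    simp [hk.symm]
  · simp

/-- The encoders of `C` send `Gᵢ (mᵢ, sᵢ)`, where `mᵢ` is the message and `sᵢ` is uniform. -/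
structure IsCosetCode {Z₁ Z₂ : Type*} (C : NonadaptiveCode F F Z₁ Z₂ N)
    (G₁ : M₁ × S₁ →ₗ[F] (Fin N → F)) (G₂ : M₂ × S₂ →ₗ[F] (Fin N → F))
    (e₁ : Fin C.L₁ ≃ M₁) (e₂ : Fin C.L₂ ≃ M₂) : Prop where
  enc₁_eq : ∀ m, C.enc₁ m = (PMF.uniformOfFintype S₁).map fun s => G₁ (e₁ m, s)
  enc₂_eq : ∀ m, C.enc₂ m = (PMF.uniformOfFintype S₂).map fun s => G₂ (e₂ m, s)

theorem isCosetCode_linearCode (a₁ b₁ a₂ b₂ : F) (P₁ P₂ : PMF F)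
    (G₁ : M₁ × S₁ →ₗ[F] (Fin N → F)) (G₂ : M₂ × S₂ →ₗ[F] (Fin N → F)) :
    IsCosetCode (linearCode a₁ b₁ a₂ b₂ P₁ P₂ G₁ G₂) G₁ G₂ (Fintype.equivFin M₁).symm
      (Fintype.equivFin M₂).symm :=
  ⟨fun _ => rfl, fun _ => rfl⟩

/-- The law of the message pair and of the eavesdropper's word of a coset code. -/
theorem toReal_messageEveLaw {Z₁ Z₂ : Type*} [Fintype Z₁] [Fintype Z₂]
    (C : NonadaptiveCode F F Z₁ Z₂ N) (W : Channel F F Z₁ Z₂ F) {a b : F} {P : PMF F}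
    (hW : ∀ x₁ x₂, (W x₁ x₂).map (fun y => y.2.2) = P.map fun n => a * x₁ + b * x₂ + n)
    {G₁ : M₁ × S₁ →ₗ[F] (Fin N → F)} {G₂ : M₂ × S₂ →ₗ[F] (Fin N → F)}
    {e₁ : Fin C.L₁ ≃ M₁} {e₂ : Fin C.L₂ ≃ M₂} (hC : IsCosetCode C G₁ G₂ e₁ e₂)
    (m₁ : Fin C.L₁) (m₂ : Fin C.L₂) (z : Fin N → F) :
    (C.messageEveLaw W ((m₁, m₂), z)).toReal =
      (C.L₁ : ℝ)⁻¹ * ((C.L₂ : ℝ)⁻¹ * ((Fintype.card S₁ : ℝ)⁻¹ * ((Fintype.card S₂ : ℝ)⁻¹ *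
        ∑ s₁, ∑ s₂, noiseLaw P N (z - (a • G₁ (e₁ m₁, s₁) + b • G₂ (e₂ m₂, s₂)))))) := by
  classical
  have hz : ∀ x₁ x₂ : Fin N → F, (W.memoryless x₁ x₂).map (fun w i => (w i).2.2) z =
      (piPMF fun _ => P) (z - (a • x₁ + b • x₂)) := fun x₁ x₂ => by
    rw [memoryless_map W (fun y => y.2.2) a b P hW, PMF.map_apply, tsum_fintype,
      Finset.sum_eq_single (z - (a • x₁ + b • x₂))]
    · simp
    · intro n _ hn
      rw [if_neg]
      rintro rfl
      simp at hn
    · simp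
  have hlaw : (C.condLaw W m₁ m₂).map (fun ω i => (ω.2.2 i).2.2) =
      (PMF.uniformOfFintype S₁).bind fun s₁ => (PMF.uniformOfFintype S₂).bind fun s₂ =>
        (W.memoryless (G₁ (e₁ m₁, s₁)) (G₂ (e₂ m₂, s₂))).map fun w i => (w i).2.2 := by
    simp only [NonadaptiveCode.condLaw, hC.enc₁_eq, hC.enc₂_eq, PMF.map_bind, PMF.map_comp, PMF.bind_map,
      Function.comp_def]
  rw [messageEveLaw_apply, hlaw]
  simp only [PMF.bind_apply, hz, tsum_fintype, PMF.uniformOfFintype_apply, ENNReal.toReal_mul,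
    ENNReal.toReal_inv, ENNReal.toReal_natCast]
  rw [← Finset.mul_sum]
  simp only [← Finset.mul_sum]
  rw [ENNReal.toReal_mul, ENNReal.toReal_mul, ENNReal.toReal_inv, ENNReal.toReal_inv,
    ENNReal.toReal_natCast, ENNReal.toReal_natCast, ENNReal.toReal_sum]
  · congr 4
    refine Finset.sum_congr rfl fun s₁ _ => ?_
    rw [ENNReal.toReal_sum fun _ _ => PMF.apply_ne_top _ _]
    rfl
  · exact fun _ _ => ENNReal.sum_ne_top.2 fun _ _ => PMF.apply_ne_top _ _

/-- The noiseless part of the eavesdropper's word as a function of the randomness that hides the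
message. -/
def eveMap {V₁ V₂ S : Type*} [AddCommGroup V₁] [AddCommGroup V₂] [AddCommGroup S] [Module F V₁]
    [Module F V₂] [Module F S] (a b : F) (j : S →ₗ[F] V₁ × V₂)
    (G : (V₁ →ₗ[F] (Fin N → F)) × (V₂ →ₗ[F] (Fin N → F))) : S →ₗ[F] (Fin N → F) :=
  ((a • G.1).coprod (b • G.2)).comp j

theorem toReal_map_fst_fst {A B Z : Type*} [Fintype A] [Fintype B] [Fintype Z]
    (P : PMF ((A × B) × Z)) (a : A) (z : Z) :
    ((P.map fun p => (p.1.1, p.2)) (a, z)).toReal = ∑ b, (P ((a, b), z)).toReal := by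
  classical
  rw [PMF.map_apply, tsum_fintype, ← ENNReal.toReal_sum fun b _ => P.apply_ne_top _]
  congr 1
  simp only [Fintype.sum_prod_type, Prod.mk.injEq, ite_and]
  rw [Finset.sum_eq_single a] <;> simp +contextual [eq_comm]

theorem toReal_map_fst_snd {A B Z : Type*} [Fintype A] [Fintype B] [Fintype Z]
    (P : PMF ((A × B) × Z)) (b : B) (z : Z) :
    ((P.map fun p => (p.1.2, p.2)) (b, z)).toReal = ∑ a, (P ((a, b), z)).toReal := by
  classical
  rw [PMF.map_apply, tsum_fintype, ← ENNReal.toReal_sum fun b _ => P.apply_ne_top _]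
  congr 1
  simp only [Fintype.sum_prod_type, Prod.mk.injEq, ite_and]
  refine Finset.sum_congr rfl fun a _ => ?_
  rw [Finset.sum_eq_single b] <;> simp +contextual [eq_comm]

/-! ### Leakage bounded by the divergence of a smeared noise law. -/

section Leakage

variable {Z₁ Z₂ : Type*} [Fintype Z₁] [Fintype Z₂] {C : NonadaptiveCode F F Z₁ Z₂ N}
  {W : Channel F F Z₁ Z₂ F} {a b : F} {P : PMF F}
  {G₁ : M₁ × S₁ →ₗ[F] (Fin N → F)} {G₂ : M₂ × S₂ →ₗ[F] (Fin N → F)}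
  {e₁ : Fin C.L₁ ≃ M₁} {e₂ : Fin C.L₂ ≃ M₂}

/-- The splitting `G (m, s) = G (m, 0) + G (0, s)` makes the message a mere translation; the local
randomness of both users does the hiding. -/
theorem leakage_le_divUniform
    (hW : ∀ x₁ x₂, (W x₁ x₂).map (fun y => y.2.2) = P.map fun n => a * x₁ + b * x₂ + n)
    (hC : IsCosetCode C G₁ G₂ e₁ e₂) :
    C.leakage W ≤ divUniform (smear (noiseLaw P N) (eveMap a b
      (LinearMap.prodMap (LinearMap.inr F M₁ S₁) (LinearMap.inr F M₂ S₂)) (G₁, G₂))) := by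
  refine mutualInfo_le_divUniform _ (fun m => a • G₁ (e₁ m.1, 0) + b • G₂ (e₂ m.2, 0))
    (smear_nonneg (noiseLaw_nonneg P N) _) (sum_smear (sum_noiseLaw P N) _) ?_
  rintro ⟨m₁, m₂⟩ z
  rw [toReal_messageEveLaw C W hW hC]
  simp only [smear, eveMap, Fintype.card_prod, Fintype.sum_prod_type, Fintype.card_fin,
    Nat.cast_mul, mul_inv, mul_assoc, LinearMap.comp_apply, LinearMap.prodMap_apply,
    LinearMap.coprod_apply, LinearMap.inr_apply, LinearMap.smul_apply]
  congr 4
  refine Finset.sum_congr rfl fun s₁ _ => Finset.sum_congr rfl fun s₂ _ => congrArg _ ?_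
  have e1 : G₁ (e₁ m₁, s₁) = G₁ (e₁ m₁, 0) + G₁ (0, s₁) := by rw [← map_add]; simp
  have e2 : G₂ (e₂ m₂, s₂) = G₂ (e₂ m₂, 0) + G₂ (0, s₂) := by rw [← map_add]; simp
  rw [e1, e2, smul_add, smul_add]
  abel

/-- The message of User 2 is uniform and independent of `M₁`, so the whole vector `(m₂, s₂)` counts
as randomness. This is why `LinearMap.id` replaces `LinearMap.inr` in the second component. -/
theorem leakage₁_le_divUniform
    (hW : ∀ x₁ x₂, (W x₁ x₂).map (fun y => y.2.2) = P.map fun n => a * x₁ + b * x₂ + n)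
    (hC : IsCosetCode C G₁ G₂ e₁ e₂) :
    C.leakage₁ W ≤ divUniform (smear (noiseLaw P N) (eveMap a b
      (LinearMap.prodMap (LinearMap.inr F M₁ S₁) LinearMap.id) (G₁, G₂))) := by
  refine mutualInfo_le_divUniform _ (fun m => a • G₁ (e₁ m, 0))
    (smear_nonneg (noiseLaw_nonneg P N) _) (sum_smear (sum_noiseLaw P N) _) ?_
  intro m₁ z
  have hcard : (C.L₂ : ℝ) = Fintype.card M₂ := by
    rw [← Fintype.card_congr e₂, Fintype.card_fin]
  have hkey : ∀ s₁ m₂ s₂, z - (a • G₁ (e₁ m₁, s₁) + b • G₂ (m₂, s₂)) =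
      z - a • G₁ (e₁ m₁, 0) - (a • G₁ (0, s₁) + b • G₂ (m₂, s₂)) := by
    intro s₁ m₂ s₂
    have e1 : G₁ (e₁ m₁, s₁) = G₁ (e₁ m₁, 0) + G₁ (0, s₁) := by rw [← map_add]; simp
    rw [e1, smul_add]
    abel
  rw [toReal_map_fst_fst]
  simp only [toReal_messageEveLaw C W hW hC]
  rw [← Finset.mul_sum, e₂.sum_comp (fun m₂ => (C.L₂ : ℝ)⁻¹ * ((Fintype.card S₁ : ℝ)⁻¹ *
    ((Fintype.card S₂ : ℝ)⁻¹ * ∑ s₁, ∑ s₂,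
      noiseLaw P N (z - (a • G₁ (e₁ m₁, s₁) + b • G₂ (m₂, s₂))))))]
  simp only [← Finset.mul_sum]
  rw [Finset.sum_comm]
  simp only [smear, eveMap, Fintype.card_prod, Fintype.sum_prod_type, Fintype.card_fin,
    Nat.cast_mul, mul_inv, LinearMap.comp_apply, LinearMap.prodMap_apply,
    LinearMap.coprod_apply, LinearMap.inr_apply, LinearMap.smul_apply, LinearMap.id_apply, hcard]
  rw [Finset.sum_congr rfl fun s₁ _ => Finset.sum_congr rfl fun m₂ _ =>
    Finset.sum_congr rfl fun s₂ _ => congrArg _ (hkey s₁ m₂ s₂)]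
  ring

theorem leakage₂_le_divUniform
    (hW : ∀ x₁ x₂, (W x₁ x₂).map (fun y => y.2.2) = P.map fun n => a * x₁ + b * x₂ + n)
    (hC : IsCosetCode C G₁ G₂ e₁ e₂) :
    C.leakage₂ W ≤ divUniform (smear (noiseLaw P N) (eveMap a b
      (LinearMap.prodMap LinearMap.id (LinearMap.inr F M₂ S₂)) (G₁, G₂))) := by
  refine mutualInfo_le_divUniform _ (fun m => b • G₂ (e₂ m, 0))
    (smear_nonneg (noiseLaw_nonneg P N) _) (sum_smear (sum_noiseLaw P N) _) ?_
  intro m₂ z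
  have hcard : (C.L₁ : ℝ) = Fintype.card M₁ := by
    rw [← Fintype.card_congr e₁, Fintype.card_fin]
  have hkey : ∀ m₁ s₁ s₂, z - (a • G₁ (m₁, s₁) + b • G₂ (e₂ m₂, s₂)) =
      z - b • G₂ (e₂ m₂, 0) - (a • G₁ (m₁, s₁) + b • G₂ (0, s₂)) := by
    intro m₁ s₁ s₂
    have e2 : G₂ (e₂ m₂, s₂) = G₂ (e₂ m₂, 0) + G₂ (0, s₂) := by rw [← map_add]; simp
    rw [e2, smul_add]
    abel
  rw [toReal_map_fst_snd]
  simp only [toReal_messageEveLaw C W hW hC]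
  rw [← Finset.mul_sum, e₁.sum_comp (fun m₁ => (C.L₂ : ℝ)⁻¹ * ((Fintype.card S₁ : ℝ)⁻¹ *
    ((Fintype.card S₂ : ℝ)⁻¹ * ∑ s₁, ∑ s₂,
      noiseLaw P N (z - (a • G₁ (m₁, s₁) + b • G₂ (e₂ m₂, s₂))))))]
  simp only [← Finset.mul_sum]
  simp only [smear, eveMap, Fintype.card_prod, Fintype.sum_prod_type, Fintype.card_fin,
    Nat.cast_mul, mul_inv, LinearMap.comp_apply, LinearMap.prodMap_apply,
    LinearMap.coprod_apply, LinearMap.inr_apply, LinearMap.smul_apply, LinearMap.id_apply, hcard]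
  rw [Finset.sum_congr rfl fun m₁ _ => Finset.sum_congr rfl fun s₁ _ =>
    Finset.sum_congr rfl fun s₂ _ => congrArg _ (hkey m₁ s₁ s₂)]
  ring

end Leakage

end LinearCode

/-! ### The ensemble of generator pairs. -/

section Ensemble

variable {F : Type*} [Field F] [Fintype F] {N : ℕ}

/-- Evaluation of linear maps at a non-zero vector is surjective, which is the hypothesis on `Φ` in
both averaging bounds. -/
theorem exists_linearMap_apply_eq {K V W : Type*} [Field K] [AddCommGroup V] [Module K V]
    [AddCommGroup W] [Module K W] {v : V} (hv : v ≠ 0) (w : W) : ∃ G : V →ₗ[K] W, G v = w := by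
  obtain ⟨f, hf⟩ := Module.Projective.exists_dual_eq_one K hv
  exact ⟨f.smulRight w, by simp [hf]⟩

variable {V₁ V₂ S : Type*} [AddCommGroup V₁] [AddCommGroup V₂] [AddCommGroup S] [Module F V₁]
  [Module F V₂] [Module F S] [Fintype S]
  [Fintype ((V₁ →ₗ[F] (Fin N → F)) × (V₂ →ₗ[F] (Fin N → F)))]

theorem sum_ambiguity_fst_le [Fintype V₁] (P : PMF F) {a : F} (ha : a ≠ 0) {θ : ℝ} (hθ : 0 ≤ θ)
    (hθ1 : θ ≤ 1) :
    ∑ G : (V₁ →ₗ[F] (Fin N → F)) × (V₂ →ₗ[F] (Fin N → F)), ambiguity (noiseLaw P N) (a • G.1) ≤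
      Fintype.card ((V₁ →ₗ[F] (Fin N → F)) × (V₂ →ₗ[F] (Fin N → F))) *
        (((Fintype.card V₁ : ℝ) / (Fintype.card F : ℝ) ^ N) ^ θ *
          (∑ x, (P x).toReal ^ (1 - θ)) ^ N) := by
  classical
  have := sum_ambiguity_le (noiseLaw_nonneg P N) (sum_noiseLaw P N)
    (fun v : V₁ => AddMonoidHom.mk'
      (fun G : (V₁ →ₗ[F] (Fin N → F)) × (V₂ →ₗ[F] (Fin N → F)) => a • G.1 v)
      (fun G G' => by simp)) (fun v hv w => by
        obtain ⟨G, hG⟩ := exists_linearMap_apply_eq (K := F) hv (a⁻¹ • w)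
        exact ⟨(G, 0), by simp [hG, ha]⟩) hθ hθ1
  rw [sum_noiseLaw_rpow, Fintype.card_fun, Fintype.card_fin, Nat.cast_pow] at this
  exact this

theorem sum_ambiguity_snd_le [Fintype V₂] (P : PMF F) {a : F} (ha : a ≠ 0) {θ : ℝ} (hθ : 0 ≤ θ)
    (hθ1 : θ ≤ 1) :
    ∑ G : (V₁ →ₗ[F] (Fin N → F)) × (V₂ →ₗ[F] (Fin N → F)), ambiguity (noiseLaw P N) (a • G.2) ≤
      Fintype.card ((V₁ →ₗ[F] (Fin N → F)) × (V₂ →ₗ[F] (Fin N → F))) *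
        (((Fintype.card V₂ : ℝ) / (Fintype.card F : ℝ) ^ N) ^ θ *
          (∑ x, (P x).toReal ^ (1 - θ)) ^ N) := by
  classical
  have := sum_ambiguity_le (noiseLaw_nonneg P N) (sum_noiseLaw P N)
    (fun v : V₂ => AddMonoidHom.mk'
      (fun G : (V₁ →ₗ[F] (Fin N → F)) × (V₂ →ₗ[F] (Fin N → F)) => a • G.2 v)
      (fun G G' => by simp)) (fun v hv w => by
        obtain ⟨G, hG⟩ := exists_linearMap_apply_eq (K := F) hv (a⁻¹ • w)
        exact ⟨(0, G), by simp [hG, ha]⟩) hθ hθ1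
  rw [sum_noiseLaw_rpow, Fintype.card_fun, Fintype.card_fin, Nat.cast_pow] at this
  exact this

/-- As `j` is injective, `s ≠ 0` leaves a non-zero vector for at least one generator. That generator
alone reaches every word, because its coefficient `a` or `b` is non-zero. -/
theorem sum_divUniform_eveMap_le (P : PMF F) {a b : F} (ha : a ≠ 0) (hb : b ≠ 0)
    {j : S →ₗ[F] V₁ × V₂} (hj : Function.Injective j) {θ : ℝ} (hθ : 0 < θ) (hθ1 : θ ≤ 1) :
    ∑ G : (V₁ →ₗ[F] (Fin N → F)) × (V₂ →ₗ[F] (Fin N → F)),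
        divUniform (smear (noiseLaw P N) (eveMap a b j G)) ≤
      Fintype.card ((V₁ →ₗ[F] (Fin N → F)) × (V₂ →ₗ[F] (Fin N → F))) *
        (((Fintype.card F : ℝ) ^ N / Fintype.card S) ^ θ *
          (∑ x, (P x).toReal ^ (1 + θ)) ^ N / θ) := by
  classical
  have := sum_divUniform_smear_le (noiseLaw_nonneg P N) (sum_noiseLaw P N)
    (fun G : (V₁ →ₗ[F] (Fin N → F)) × (V₂ →ₗ[F] (Fin N → F)) => (eveMap a b j G).toAddMonoidHom)
    (fun s => AddMonoidHom.mk'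
      (fun G : (V₁ →ₗ[F] (Fin N → F)) × (V₂ →ₗ[F] (Fin N → F)) => eveMap a b j G s)
      (fun G G' => by simp only [eveMap, LinearMap.comp_apply, LinearMap.coprod_apply,
        LinearMap.smul_apply, Prod.fst_add, Prod.snd_add, LinearMap.add_apply, smul_add]; abel))
    (fun _ _ => rfl) (fun s hs w => by
      have hjs : j s ≠ 0 := fun h => hs (hj (by rw [h, map_zero]))
      rcases ne_or_eq (j s).1 0 with h | h
      · obtain ⟨G, hG⟩ := exists_linearMap_apply_eq (K := F) h (a⁻¹ • w)
        exact ⟨(G, 0), by simp [eveMap, hG, ha]⟩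
      · obtain ⟨G, hG⟩ := exists_linearMap_apply_eq (K := F)
          (fun h' => hjs (Prod.ext h h') : (j s).2 ≠ 0) (b⁻¹ • w)
        exact ⟨(0, G), by simp [eveMap, hG, hb]⟩) hθ hθ1
  rw [sum_noiseLaw_rpow, Fintype.card_fun, Fintype.card_fin, Nat.cast_pow] at this
  exact this

end Ensemble

/-! ### Exponential decay of the two averages. -/

section Exponents

variable {F : Type*} [Fintype F]

/-- The random coding exponent is positive at rates below `log q - H`. -/
theorem exists_ambiguity_exponent [Nonempty F] (P : PMF F) {δ : ℝ} (hδ : 0 < δ) :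
    ∃ θ r : ℝ, 0 ≤ θ ∧ θ ≤ 1 ∧ 0 ≤ r ∧ r < 1 ∧ ∀ (N : ℕ) (x : ℝ), 0 ≤ x →
      x ≤ Real.exp (N * (Real.log (Fintype.card F) - entropy P - δ)) →
      (x / (Fintype.card F : ℝ) ^ N) ^ θ * (∑ a, (P a).toReal ^ (1 - θ)) ^ N ≤ r ^ N := by
  have hq : (0 : ℝ) < Fintype.card F := by exact_mod_cast Fintype.card_pos
  obtain ⟨θ, hθ, hθ1, hr⟩ := exists_exp_neg_mul_sum_rpow_lt_one P
    (show entropy P < entropy P + δ by linarith)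
  have hs : 0 ≤ ∑ a, (P a).toReal ^ (1 - θ) :=
    Finset.sum_nonneg fun _ _ => Real.rpow_nonneg ENNReal.toReal_nonneg _
  refine ⟨θ, _, hθ.le, hθ1, mul_nonneg (Real.exp_pos _).le hs, hr, fun N x hx hxle => ?_⟩
  rw [mul_pow]
  gcongr
  have h1 : x / (Fintype.card F : ℝ) ^ N ≤ Real.exp (N * -(entropy P + δ)) := by
    rw [div_le_iff₀ (by positivity)]
    refine hxle.trans (le_of_eq ?_)
    nth_rw 2 [← Real.exp_log hq]
    rw [← Real.exp_nat_mul, ← Real.exp_add]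
    ring_nf
  refine (Real.rpow_le_rpow (by positivity) h1 hθ.le).trans (le_of_eq ?_)
  rw [← Real.exp_mul, ← Real.exp_nat_mul]
  ring_nf

/-- The resolvability exponent is positive at rates above `log q - H`. -/
theorem exists_resolvability_exponent [Nonempty F] (P : PMF F) {δ : ℝ} (hδ : 0 < δ) :
    ∃ θ r K : ℝ, 0 < θ ∧ θ ≤ 1 ∧ 0 ≤ r ∧ r < 1 ∧ 0 ≤ K ∧ ∀ (N : ℕ) (x : ℝ),
      Real.exp (N * (Real.log (Fintype.card F) - entropy P + δ) -
        2 * Real.log (Fintype.card F)) ≤ x →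
      ((Fintype.card F : ℝ) ^ N / x) ^ θ * (∑ a, (P a).toReal ^ (1 + θ)) ^ N / θ ≤ K * r ^ N := by
  have hq : (0 : ℝ) < Fintype.card F := by exact_mod_cast Fintype.card_pos
  obtain ⟨θ, hθ, hθ1, hr⟩ := exists_exp_mul_sum_rpow_lt_one P
    (show entropy P - δ < entropy P by linarith)
  have hs : 0 ≤ ∑ a, (P a).toReal ^ (1 + θ) :=
    Finset.sum_nonneg fun _ _ => Real.rpow_nonneg ENNReal.toReal_nonneg _
  -- The constant absorbs the `2 log q` nats allowed for rounding, one symbol per user.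
  refine ⟨θ, _, Real.exp (2 * Real.log (Fintype.card F) * θ) / θ, hθ, hθ1,
    mul_nonneg (Real.exp_pos _).le hs, hr, by positivity, fun N x hx => ?_⟩
  have hx0 : 0 < x := (Real.exp_pos _).trans_le hx
  rw [mul_pow, div_mul_eq_mul_div, ← mul_assoc]
  gcongr
  have h1 : (Fintype.card F : ℝ) ^ N / x ≤
      Real.exp (2 * Real.log (Fintype.card F) + N * (entropy P - δ)) := by
    rw [div_le_iff₀ hx0]
    refine le_trans (le_of_eq ?_) (mul_le_mul_of_nonneg_left hx (Real.exp_pos _).le)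
    nth_rw 1 [← Real.exp_log hq]
    rw [← Real.exp_nat_mul, ← Real.exp_add]
    ring_nf
  refine (Real.rpow_le_rpow (by positivity) h1 hθ.le).trans (le_of_eq ?_)
  rw [← Real.exp_mul, ← Real.exp_nat_mul, ← Real.exp_add]
  ring_nf

end Exponents

/-! ### Removal of the rate slack. -/

section Diagonal

/-- Taking a near-minimizer of `f n` for each `n` replaces an explicit diagonal sequence of
tolerances. -/
theorem exists_tendsto_zero_of_forall_eventually {α : ℕ → Type*} [∀ n, Nonempty (α n)]
    (f : ∀ n, α n → ℝ) (hf : ∀ n a, 0 ≤ f n a)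
    (h : ∀ ε > 0, ∀ᶠ n in atTop, ∃ a, f n a ≤ ε) :
    ∃ a : ∀ n, α n, Tendsto (fun n => f n (a n)) atTop (𝓝 0) := by
  have hb : ∀ n, BddBelow (Set.range (f n)) := fun n => ⟨0, by rintro _ ⟨a, rfl⟩; exact hf n a⟩
  have h1 : ∀ n : ℕ, ∃ a, f n a < (⨅ a, f n a) + 1 / ((n : ℝ) + 1) := fun n =>
    exists_lt_of_ciInf_lt (lt_add_of_pos_right _ (by positivity))
  choose a ha using h1
  refine ⟨a, ?_⟩
  rw [Metric.tendsto_atTop']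
  intro ε hε
  have h2 := (h (ε / 2) (by positivity)).and
    (tendsto_one_div_add_atTop_nhds_zero_nat.eventually (gt_mem_nhds (half_pos hε)))
  obtain ⟨n₀, hn₀⟩ := eventually_atTop.1 h2
  refine ⟨n₀, fun n hn => ?_⟩
  obtain ⟨⟨b, hb'⟩, hlt⟩ := hn₀ n hn.le
  rw [Real.dist_eq, sub_zero, abs_of_nonneg (hf _ _)]
  have := ciInf_le (hb n) b
  have := ha n
  linarith

end Diagonal

/-! ### Numbers of message and random symbols. -/

section Parameters

/-- Numbers `k` of message symbols and `l` of random symbols that fit the rate `R`, the capacity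
`c` and the tolerance `δ` at block length `N`, where a symbol carries `L` nats. -/
structure SymbolCounts (L c R δ : ℝ) (N k l : ℕ) : Prop where
  total_le : k + l = 0 ∨ (k + l) * L ≤ N * (c - δ)
  le_total : N * (c - δ) - L ≤ (k + l) * L
  message_le : k = 0 ∨ k * L ≤ N * (R - 3 * δ)
  message_le_rate : k * L ≤ N * R
  le_message : N * (R - 3 * δ) - L ≤ k * L

/-- Take `k = ⌊N (R - 3δ) / L⌋` and `k + l = ⌊N (c - δ) / L⌋`. A negative argument has floor 0,
whence the alternatives in the structure. Filling both totals only to `c - δ` costs `2δ` of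
randomness; lowering a message rate by `3δ` regains it and leaves the margin `δ` for resolvability.
-/
theorem exists_symbolCounts {L c R δ : ℝ} (hL : 0 < L) (hR : 0 ≤ R) (hRc : R ≤ c) (hδ : 0 < δ)
    (N : ℕ) : ∃ k l, SymbolCounts L c R δ N k l := by
  have aux : ∀ x : ℝ, (⌊N * x / L⌋₊ = 0 ∨ (⌊N * x / L⌋₊ : ℝ) * L ≤ N * x) ∧
      N * x - L ≤ ⌊N * x / L⌋₊ * L := by
    intro x
    constructor
    · rcases le_or_gt 0 (N * x / L) with h | h
      · exact Or.inr ((le_div_iff₀ hL).1 (Nat.floor_le h))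
      · exact Or.inl (Nat.floor_of_nonpos h.le)
    · have := (div_lt_iff₀ hL).1 (Nat.lt_floor_add_one (N * x / L))
      linarith
  have hkt : ⌊N * (R - 3 * δ) / L⌋₊ ≤ ⌊N * (c - δ) / L⌋₊ := by
    refine Nat.floor_le_floor ?_
    gcongr
    linarith
  obtain ⟨l, hl⟩ := Nat.exists_eq_add_of_le hkt
  obtain ⟨h1, h2⟩ := aux (c - δ)
  obtain ⟨h3, h4⟩ := aux (R - 3 * δ)
  rw [hl] at h1 h2
  refine ⟨_, l, by exact_mod_cast h1, by exact_mod_cast h2, h3, ?_, h4⟩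
  rcases h3 with h | h
  · rw [h, Nat.cast_zero, zero_mul]
    positivity
  · refine h.trans (mul_le_mul_of_nonneg_left ?_ (Nat.cast_nonneg _))
    linarith

theorem SymbolCounts.abs_rate_sub_le {L c R δ : ℝ} {N k l : ℕ} (h : SymbolCounts L c R δ N k l)
    (hL : 0 < L) (hδ : 0 < δ) (hN : 0 < N) : |k * L / N - R| ≤ 3 * δ + L / N := by
  have hN' : (0 : ℝ) < N := by exact_mod_cast hN
  have h1 := h.message_le_rate
  have h2 := h.le_message
  have h3 : k * L / N ≤ R := by rw [div_le_iff₀ hN']; linarith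
  have h4 : R - 3 * δ ≤ k * L / N + L / N := by
    rw [← add_div, le_div_iff₀ hN']
    linarith
  have : 0 < L / N := by positivity
  rw [abs_le]
  constructor <;> linarith

end Parameters

/-! ### Achievability of the two regions. -/

section Achievability

universe u

variable {F : Type*} [Field F] [Fintype F]

instance fintypeLinearMap {V W : Type*} [AddCommGroup V] [AddCommGroup W] [Module F V] [Module F W]
    [Finite V] [Finite W] : Fintype (V →ₗ[F] W) :=
  haveI := Finite.of_injective (fun f : V →ₗ[F] W => (f : V → W)) DFunLike.coe_injective
  Fintype.ofFinite _

/-- The pairs of generator maps with `kᵢ` message symbols and `lᵢ` random symbols. -/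
abbrev Generators (F : Type*) [Field F] (N k₁ l₁ k₂ l₂ : ℕ) :=
  (((Fin k₁ → F) × (Fin l₁ → F)) →ₗ[F] (Fin N → F)) ×
    (((Fin k₂ → F) × (Fin l₂ → F)) →ₗ[F] (Fin N → F))

theorem card_symbols (k : ℕ) :
    (Fintype.card (Fin k → F) : ℝ) = Real.exp (k * Real.log (Fintype.card F)) := by
  have hq : (0 : ℝ) < Fintype.card F := by exact_mod_cast Fintype.card_pos
  rw [Fintype.card_fun, Fintype.card_fin, Nat.cast_pow, Real.exp_nat_mul, Real.exp_log hq]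

theorem log_card_pos : 0 < Real.log (Fintype.card F) :=
  Real.log_pos (by exact_mod_cast Fintype.one_lt_card)

theorem exists_sum_ambiguity_le (P : PMF F) {δ : ℝ} (hδ : 0 < δ) :
    ∃ β : ℕ → ℝ, Tendsto β atTop (𝓝 0) ∧ ∀ {N k₁ l₁ k₂ l₂ : ℕ} {R : ℝ} {a : F}, a ≠ 0 →
      (SymbolCounts (Real.log (Fintype.card F)) (Real.log (Fintype.card F) - entropy P) R δ
          N k₁ l₁ →
        ∑ G : Generators F N k₁ l₁ k₂ l₂, ambiguity (noiseLaw P N) (a • G.1) ≤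
          Fintype.card (Generators F N k₁ l₁ k₂ l₂) * β N) ∧
      (SymbolCounts (Real.log (Fintype.card F)) (Real.log (Fintype.card F) - entropy P) R δ
          N k₂ l₂ →
        ∑ G : Generators F N k₁ l₁ k₂ l₂, ambiguity (noiseLaw P N) (a • G.2) ≤
          Fintype.card (Generators F N k₁ l₁ k₂ l₂) * β N) := by
  obtain ⟨θ, r, hθ, hθ1, hr, hr1, h⟩ := exists_ambiguity_exponent P hδ
  refine ⟨fun N => r ^ N, tendsto_pow_atTop_nhds_zero_of_lt_one hr hr1, ?_⟩
  intro N k₁ l₁ k₂ l₂ R a ha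
  have key : ∀ {k l : ℕ}, (k + l) * Real.log (Fintype.card F) ≤
      N * (Real.log (Fintype.card F) - entropy P - δ) →
      ((Fintype.card ((Fin k → F) × (Fin l → F)) : ℝ) / (Fintype.card F : ℝ) ^ N) ^ θ *
        (∑ a, (P a).toReal ^ (1 - θ)) ^ N ≤ r ^ N := by
    intro k l hkl
    refine h N _ (Nat.cast_nonneg _) ?_
    rw [Fintype.card_prod, Nat.cast_mul, card_symbols, card_symbols, ← Real.exp_add, ← add_mul]
    exact Real.exp_le_exp.2 hkl
  constructor
  · intro hs
    rcases hs.total_le with h0 | h1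
    -- With no symbols at all there is a single codeword, hence no ambiguity, although `c - δ` may
    -- be negative.
    · obtain ⟨rfl, rfl⟩ := Nat.add_eq_zero_iff.1 h0
      simp only [ambiguity_of_subsingleton, Finset.sum_const_zero]
      positivity
    · exact (sum_ambiguity_fst_le P ha hθ hθ1).trans
        (mul_le_mul_of_nonneg_left (key h1) (Nat.cast_nonneg _))
  · intro hs
    rcases hs.total_le with h0 | h1
    · obtain ⟨rfl, rfl⟩ := Nat.add_eq_zero_iff.1 h0
      simp only [ambiguity_of_subsingleton, Finset.sum_const_zero]
      positivity
    · exact (sum_ambiguity_snd_le P ha hθ hθ1).trans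
        (mul_le_mul_of_nonneg_left (key h1) (Nat.cast_nonneg _))

/-- The sequence `β` is fixed before the symbol counts and `j`, so it depends only on the noise law
and `δ`. -/
theorem exists_sum_divUniform_le {F : Type u} [Field F] [Fintype F] (P : PMF F) {δ : ℝ}
    (hδ : 0 < δ) :
    ∃ β : ℕ → ℝ, Tendsto β atTop (𝓝 0) ∧ (∀ N, 0 ≤ β N) ∧ ∀ {N k₁ l₁ k₂ l₂ : ℕ} {a b : F}
      {S : Type u} [AddCommGroup S] [Module F S] [Fintype S]
      {j : S →ₗ[F] ((Fin k₁ → F) × (Fin l₁ → F)) × ((Fin k₂ → F) × (Fin l₂ → F))},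
      a ≠ 0 → b ≠ 0 → Function.Injective j →
      Real.exp (N * (Real.log (Fintype.card F) - entropy P + δ) -
        2 * Real.log (Fintype.card F)) ≤ Fintype.card S →
      ∑ G : Generators F N k₁ l₁ k₂ l₂, divUniform (smear (noiseLaw P N) (eveMap a b j G)) ≤
        Fintype.card (Generators F N k₁ l₁ k₂ l₂) * β N := by
  obtain ⟨θ, r, K, hθ, hθ1, hr, hr1, hK, h⟩ := exists_resolvability_exponent P hδ
  refine ⟨fun N => K * r ^ N, ?_, fun N => by positivity, ?_⟩
  · simpa using (tendsto_pow_atTop_nhds_zero_of_lt_one hr hr1).const_mul K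
  · intro N k₁ l₁ k₂ l₂ a b S _ _ _ j ha hb hj hS
    exact (sum_divUniform_eveMap_le P ha hb hj hθ hθ1).trans
      (mul_le_mul_of_nonneg_left (h N _ hS) (Nat.cast_nonneg _))

theorem divUniform_eveMap_nonneg {V₁ V₂ S : Type*} [AddCommGroup V₁] [AddCommGroup V₂]
    [AddCommGroup S] [Module F V₁] [Module F V₂] [Module F S] [Fintype S] {N : ℕ} (P : PMF F)
    (a b : F) (j : S →ₗ[F] V₁ × V₂)
    (G : (V₁ →ₗ[F] (Fin N → F)) × (V₂ →ₗ[F] (Fin N → F))) :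
    0 ≤ divUniform (smear (noiseLaw P N) (eveMap a b j G)) :=
  divUniform_nonneg (smear_nonneg (noiseLaw_nonneg P N) _) (sum_smear (sum_noiseLaw P N) _)

section LinearCode

variable {M₁ M₂ S₁ S₂ : Type*} [AddCommGroup M₁] [AddCommGroup M₂] [AddCommGroup S₁]
  [AddCommGroup S₂] [Module F M₁] [Module F M₂] [Module F S₁] [Module F S₂]
  [Fintype M₁] [Fintype M₂] [Fintype S₁] [Fintype S₂] {N : ℕ}

/-- The maximum with 0 supplies the nonnegative functional required by `exists_codes` without a
proof that mutual information is nonnegative. -/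
theorem max_leakage_linearCode_le (a₁ b₁ a₂ b₂ a₃ b₃ : F) (P₁ P₂ P₃ : PMF F)
    (G₁ : M₁ × S₁ →ₗ[F] (Fin N → F)) (G₂ : M₂ × S₂ →ₗ[F] (Fin N → F)) :
    max ((linearCode a₁ b₁ a₂ b₂ P₁ P₂ G₁ G₂).leakage
      (additiveChannel a₁ b₁ a₂ b₂ a₃ b₃ P₁ P₂ P₃)) 0 ≤
    divUniform (smear (noiseLaw P₃ N) (eveMap a₃ b₃ (LinearMap.prodMap
      (LinearMap.inr F M₁ S₁) (LinearMap.inr F M₂ S₂)) (G₁, G₂))) :=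
  max_le (leakage_le_divUniform (additiveChannel_map_snd_snd _ _ _ _ _ _ _ _ _)
    (isCosetCode_linearCode _ _ _ _ _ _ G₁ G₂)) (divUniform_eveMap_nonneg _ _ _ _ _)

theorem max_leakage₁_linearCode_le (a₁ b₁ a₂ b₂ a₃ b₃ : F) (P₁ P₂ P₃ : PMF F)
    (G₁ : M₁ × S₁ →ₗ[F] (Fin N → F)) (G₂ : M₂ × S₂ →ₗ[F] (Fin N → F)) :
    max ((linearCode a₁ b₁ a₂ b₂ P₁ P₂ G₁ G₂).leakage₁
      (additiveChannel a₁ b₁ a₂ b₂ a₃ b₃ P₁ P₂ P₃)) 0 ≤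
    divUniform (smear (noiseLaw P₃ N) (eveMap a₃ b₃ (LinearMap.prodMap
      (LinearMap.inr F M₁ S₁) LinearMap.id) (G₁, G₂))) :=
  max_le (leakage₁_le_divUniform (additiveChannel_map_snd_snd _ _ _ _ _ _ _ _ _)
    (isCosetCode_linearCode _ _ _ _ _ _ G₁ G₂)) (divUniform_eveMap_nonneg _ _ _ _ _)

theorem max_leakage₂_linearCode_le (a₁ b₁ a₂ b₂ a₃ b₃ : F) (P₁ P₂ P₃ : PMF F)
    (G₁ : M₁ × S₁ →ₗ[F] (Fin N → F)) (G₂ : M₂ × S₂ →ₗ[F] (Fin N → F)) :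
    max ((linearCode a₁ b₁ a₂ b₂ P₁ P₂ G₁ G₂).leakage₂
      (additiveChannel a₁ b₁ a₂ b₂ a₃ b₃ P₁ P₂ P₃)) 0 ≤
    divUniform (smear (noiseLaw P₃ N) (eveMap a₃ b₃ (LinearMap.prodMap
      LinearMap.id (LinearMap.inr F M₂ S₂)) (G₁, G₂))) :=
  max_le (leakage₂_le_divUniform (additiveChannel_map_snd_snd _ _ _ _ _ _ _ _ _)
    (isCosetCode_linearCode _ _ _ _ _ _ G₁ G₂)) (divUniform_eveMap_nonneg _ _ _ _ _)

end LinearCode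

instance {X₁ X₂ Y₁ Y₂ : Type*} [Nonempty X₁] [Nonempty X₂] (n : ℕ) :
    Nonempty (NonadaptiveCode X₁ X₂ Y₁ Y₂ n) :=
  ⟨{ L₁ := 1
     L₂ := 1
     enc₁ := fun _ => PMF.pure (Classical.arbitrary _)
     enc₂ := fun _ => PMF.pure (Classical.arbitrary _)
     dec₁ := fun _ _ => 0
     dec₂ := fun _ _ => 0 }⟩

/-- Rates below the two capacities are achievable, if the leakage functional vanishes on average
over the ensemble of coset codes. -/
theorem exists_codes {a₁ b₁ a₂ b₂ : F} (a₃ b₃ : F) {P₁ P₂ : PMF F} (P₃ : PMF F)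
    (hb₁ : b₁ ≠ 0) (ha₂ : a₂ ≠ 0) {R : ℝ × ℝ} (hR₁ : 0 ≤ R.1) (hR₂ : 0 ≤ R.2)
    (hc₁ : R.1 ≤ Real.log (Fintype.card F) - entropy P₂)
    (hc₂ : R.2 ≤ Real.log (Fintype.card F) - entropy P₁)
    (leak : ∀ N, NonadaptiveCode F F F F N → ℝ) (hleak0 : ∀ N C, 0 ≤ leak N C)
    (hleak : ∀ δ > 0, ∃ β : ℕ → ℝ, Tendsto β atTop (𝓝 0) ∧ ∀ N k₁ l₁ k₂ l₂ : ℕ,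
      SymbolCounts (Real.log (Fintype.card F)) (Real.log (Fintype.card F) - entropy P₂) R.1 δ
        N k₁ l₁ →
      SymbolCounts (Real.log (Fintype.card F)) (Real.log (Fintype.card F) - entropy P₁) R.2 δ
        N k₂ l₂ →
      ∑ G : Generators F N k₁ l₁ k₂ l₂, leak N (linearCode a₁ b₁ a₂ b₂ P₁ P₂ G.1 G.2) ≤
        Fintype.card (Generators F N k₁ l₁ k₂ l₂) * β N) :
    ∃ (C : ∀ n, NonadaptiveCode F F F F n) (ε : ℕ → ℝ),
      Tendsto (fun n => (C n).rate₁) atTop (𝓝 R.1) ∧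
      Tendsto (fun n => (C n).rate₂) atTop (𝓝 R.2) ∧ Tendsto ε atTop (𝓝 0) ∧
      (∀ n, (C n).errorProb (additiveChannel a₁ b₁ a₂ b₂ a₃ b₃ P₁ P₂ P₃) ≤ ε n) ∧
      ∀ n, leak n (C n) ≤ ε n := by
  set W := additiveChannel a₁ b₁ a₂ b₂ a₃ b₃ P₁ P₂ P₃ with hW
  set L := Real.log (Fintype.card F) with hL
  have hL0 : 0 < L := log_card_pos
  -- All defects are summed into one nonnegative functional, so that a single sequence of codes
  -- controls them together.
  obtain ⟨C, hC⟩ := exists_tendsto_zero_of_forall_eventually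
    (fun n (C : NonadaptiveCode F F F F n) => |C.rate₁ - R.1| + |C.rate₂ - R.2| +
      max (C.errorProb W) 0 + leak n C) (fun n C => by have := hleak0 n C; positivity) (by
    intro ε hε
    -- Each rate misses its target by at most `3δ + L / N`; the two terms `3δ` use up half of `ε`.
    obtain ⟨δ, hδ, hδε⟩ : ∃ δ : ℝ, 0 < δ ∧ 6 * δ ≤ ε / 2 :=
      ⟨ε / 12, by positivity, by linarith⟩
    obtain ⟨β₁, hβ₁, h₁⟩ := exists_sum_ambiguity_le P₁ hδ
    obtain ⟨β₂, hβ₂, h₂⟩ := exists_sum_ambiguity_le P₂ hδ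
    obtain ⟨β₃, hβ₃, h₃⟩ := hleak δ hδ
    have hlim : Tendsto (fun N : ℕ => L / N + L / N + (β₂ N + β₁ N + β₃ N)) atTop (𝓝 0) := by
      have := tendsto_const_div_atTop_nhds_zero_nat L
      simpa using (this.add this).add ((hβ₂.add hβ₁).add hβ₃)
    filter_upwards [hlim.eventually (gt_mem_nhds (half_pos hε)), eventually_gt_atTop 0]
      with N hN hN0
    obtain ⟨k₁, l₁, hs₁⟩ := exists_symbolCounts hL0 hR₁ hc₁ hδ N
    obtain ⟨k₂, l₂, hs₂⟩ := exists_symbolCounts hL0 hR₂ hc₂ hδ N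
    have hsum : ∑ G : Generators F N k₁ l₁ k₂ l₂,
        (ambiguity (noiseLaw P₂ N) (a₂ • G.1) + ambiguity (noiseLaw P₁ N) (b₁ • G.2) +
          leak N (linearCode a₁ b₁ a₂ b₂ P₁ P₂ G.1 G.2)) ≤
        ∑ _G : Generators F N k₁ l₁ k₂ l₂, (β₂ N + β₁ N + β₃ N) := by
      rw [Finset.sum_add_distrib, Finset.sum_add_distrib, Finset.sum_const, Finset.card_univ,
        nsmul_eq_mul, mul_add, mul_add]
      exact add_le_add (add_le_add ((h₂ ha₂).1 hs₁) ((h₁ hb₁).2 hs₂)) (h₃ N k₁ l₁ k₂ l₂ hs₁ hs₂)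
    -- Some generator pair does no worse than the ensemble average of the combined defect.
    obtain ⟨G, -, hG⟩ := Finset.exists_le_of_sum_le Finset.univ_nonempty hsum
    refine ⟨linearCode a₁ b₁ a₂ b₂ P₁ P₂ G.1 G.2, ?_⟩
    have hr₁ : (linearCode a₁ b₁ a₂ b₂ P₁ P₂ G.1 G.2).rate₁ = k₁ * L / N := by
      unfold NonadaptiveCode.rate₁
      change Real.log (Fintype.card (Fin k₁ → F)) / N = _
      rw [card_symbols, Real.log_exp]
    have hr₂ : (linearCode a₁ b₁ a₂ b₂ P₁ P₂ G.1 G.2).rate₂ = k₂ * L / N := by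
      unfold NonadaptiveCode.rate₂
      change Real.log (Fintype.card (Fin k₂ → F)) / N = _
      rw [card_symbols, Real.log_exp]
    have he : max ((linearCode a₁ b₁ a₂ b₂ P₁ P₂ G.1 G.2).errorProb W) 0 ≤
        ambiguity (noiseLaw P₂ N) (a₂ • G.1) + ambiguity (noiseLaw P₁ N) (b₁ • G.2) :=
      max_le (errorProb_linearCode_le a₁ b₁ a₂ b₂ a₃ b₃ P₁ P₂ P₃ G.1 G.2)
        (add_nonneg (ambiguity_nonneg (noiseLaw_nonneg _ _) _)
          (ambiguity_nonneg (noiseLaw_nonneg _ _) _))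
    have hd₁ := hs₁.abs_rate_sub_le hL0 hδ hN0
    have hd₂ := hs₂.abs_rate_sub_le hL0 hδ hN0
    rw [hr₁, hr₂]
    linarith)
  have hb : ∀ n, |(C n).rate₁ - R.1| + |(C n).rate₂ - R.2| + max ((C n).errorProb W) 0 +
      leak n (C n) ≥ max (|(C n).rate₁ - R.1|) (|(C n).rate₂ - R.2|) ∧
      |(C n).rate₁ - R.1| + |(C n).rate₂ - R.2| + max ((C n).errorProb W) 0 + leak n (C n) ≥
      max ((C n).errorProb W) (leak n (C n)) := by
    intro n
    have h1 := hleak0 n (C n)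
    have h2 := abs_nonneg ((C n).rate₁ - R.1)
    have h3 := abs_nonneg ((C n).rate₂ - R.2)
    have h4 := le_max_left ((C n).errorProb W) 0
    have h5 := le_max_right ((C n).errorProb W) 0
    constructor <;> refine max_le ?_ ?_ <;> linarith
  refine ⟨C, _, ?_, ?_, hC, fun n => (le_max_left _ _).trans (hb n).2,
    fun n => (le_max_right _ _).trans (hb n).2⟩
  · exact tendsto_iff_norm_sub_tendsto_zero.2 (squeeze_zero (fun n => norm_nonneg _)
      (fun n => (le_max_left _ _).trans (hb n).1) hC)
  · exact tendsto_iff_norm_sub_tendsto_zero.2 (squeeze_zero (fun n => norm_nonneg _)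
      (fun n => (le_max_right _ _).trans (hb n).1) hC)

theorem exists_sum_leakage_le {F : Type u} [Field F] [Fintype F] (a₁ b₁ a₂ b₂ : F) {a₃ b₃ : F}
    (P₁ P₂ P₃ : PMF F) (ha₃ : a₃ ≠ 0) (hb₃ : b₃ ≠ 0) {R : ℝ × ℝ}
    (hR₁ : 0 ≤ R.1) (hR₂ : 0 ≤ R.2) (hR : R.1 + R.2 ≤
      Real.log (Fintype.card F) + entropy P₃ - entropy P₁ - entropy P₂) {δ : ℝ} (hδ : 0 < δ) :
    ∃ β : ℕ → ℝ, Tendsto β atTop (𝓝 0) ∧ ∀ N k₁ l₁ k₂ l₂ : ℕ,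
      SymbolCounts (Real.log (Fintype.card F)) (Real.log (Fintype.card F) - entropy P₂) R.1 δ
        N k₁ l₁ →
      SymbolCounts (Real.log (Fintype.card F)) (Real.log (Fintype.card F) - entropy P₁) R.2 δ
        N k₂ l₂ →
      ∑ G : Generators F N k₁ l₁ k₂ l₂, max ((linearCode a₁ b₁ a₂ b₂ P₁ P₂ G.1 G.2).leakage
        (additiveChannel a₁ b₁ a₂ b₂ a₃ b₃ P₁ P₂ P₃)) 0 ≤
        Fintype.card (Generators F N k₁ l₁ k₂ l₂) * β N := by
  obtain ⟨β, hβ, hβ0, h⟩ := exists_sum_divUniform_le P₃ hδ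
  refine ⟨β, hβ, fun N k₁ l₁ k₂ l₂ hs₁ hs₂ => ?_⟩
  -- If both message sets are trivial, neither slack of `3δ` is available, but nothing can leak.
  by_cases hk : k₁ = 0 ∧ k₂ = 0
  · obtain ⟨rfl, rfl⟩ := hk
    have hz : ∀ G : Generators F N 0 l₁ 0 l₂, (linearCode a₁ b₁ a₂ b₂ P₁ P₂ G.1 G.2).leakage
        (additiveChannel a₁ b₁ a₂ b₂ a₃ b₃ P₁ P₂ P₃) = 0 := fun G =>
      haveI : Subsingleton (Fin (linearCode a₁ b₁ a₂ b₂ P₁ P₂ G.1 G.2).L₁) :=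
        (Fintype.equivFin (Fin 0 → F)).symm.subsingleton
      haveI : Subsingleton (Fin (linearCode a₁ b₁ a₂ b₂ P₁ P₂ G.1 G.2).L₂) :=
        (Fintype.equivFin (Fin 0 → F)).symm.subsingleton
      mutualInfo_of_subsingleton _
    simp only [hz, max_self, Finset.sum_const_zero]
    exact mul_nonneg (Nat.cast_nonneg _) (hβ0 N)
  · refine (Finset.sum_le_sum fun G _ => max_leakage_linearCode_le (M₁ := Fin k₁ → F)
      (M₂ := Fin k₂ → F) (S₁ := Fin l₁ → F) (S₂ := Fin l₂ → F) a₁ b₁ a₂ b₂ a₃ b₃ P₁ P₂ P₃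
      G.1 G.2).trans (h ha₃ hb₃ ?_ ?_)
    · rw [LinearMap.coe_prodMap]
      exact Prod.map_injective.2 ⟨LinearMap.inr_injective, LinearMap.inr_injective⟩
    · rw [Fintype.card_prod, Nat.cast_mul, card_symbols, card_symbols, ← Real.exp_add,
        Real.exp_le_exp]
      have h1 := hs₁.le_total
      have h2 := hs₂.le_total
      have hN : (0 : ℝ) ≤ N := Nat.cast_nonneg N
      have e1 := mul_le_mul_of_nonneg_left hR hN
      have e2 := mul_nonneg hN hR₁
      have e3 := mul_nonneg hN hR₂
      have e4 := mul_nonneg hN hδ.le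
      -- One slack of `3δ` suffices against the loss `2δ`. If the other user has no message symbols,
      -- nonnegativity of its rate closes the estimate.
      rcases hs₁.message_le with m1 | m1 <;> rcases hs₂.message_le with m2 | m2
      · exact absurd ⟨m1, m2⟩ hk
      · subst m1
        push_cast at *
        linarith
      · subst m2
        push_cast at *
        linarith
      · linarith

theorem exists_sum_leakage₁_le {F : Type u} [Field F] [Fintype F] (a₁ b₁ a₂ b₂ : F) {a₃ b₃ : F}
    (P₁ P₂ P₃ : PMF F) (ha₃ : a₃ ≠ 0) (hb₃ : b₃ ≠ 0) {R : ℝ × ℝ}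
    (hR : R.1 ≤ Real.log (Fintype.card F) + entropy P₃ - entropy P₁ - entropy P₂)
    {δ : ℝ} (hδ : 0 < δ) :
    ∃ β : ℕ → ℝ, Tendsto β atTop (𝓝 0) ∧ ∀ N k₁ l₁ k₂ l₂ : ℕ,
      SymbolCounts (Real.log (Fintype.card F)) (Real.log (Fintype.card F) - entropy P₂) R.1 δ
        N k₁ l₁ →
      SymbolCounts (Real.log (Fintype.card F)) (Real.log (Fintype.card F) - entropy P₁) R.2 δ
        N k₂ l₂ →
      ∑ G : Generators F N k₁ l₁ k₂ l₂, max ((linearCode a₁ b₁ a₂ b₂ P₁ P₂ G.1 G.2).leakage₁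
        (additiveChannel a₁ b₁ a₂ b₂ a₃ b₃ P₁ P₂ P₃)) 0 ≤
        Fintype.card (Generators F N k₁ l₁ k₂ l₂) * β N := by
  obtain ⟨β, hβ, hβ0, h⟩ := exists_sum_divUniform_le P₃ hδ
  refine ⟨β, hβ, fun N k₁ l₁ k₂ l₂ hs₁ hs₂ => ?_⟩
  -- Here only the slack of User 1 can help, since `k₂` counts as randomness; without it `M₁` is
  -- constant.
  rcases hs₁.message_le with rfl | hm
  · have hz : ∀ G : Generators F N 0 l₁ k₂ l₂, (linearCode a₁ b₁ a₂ b₂ P₁ P₂ G.1 G.2).leakage₁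
        (additiveChannel a₁ b₁ a₂ b₂ a₃ b₃ P₁ P₂ P₃) = 0 := fun G =>
      haveI : Subsingleton (Fin (linearCode a₁ b₁ a₂ b₂ P₁ P₂ G.1 G.2).L₁) :=
        (Fintype.equivFin (Fin 0 → F)).symm.subsingleton
      mutualInfo_of_subsingleton _
    simp only [hz, max_self, Finset.sum_const_zero]
    exact mul_nonneg (Nat.cast_nonneg _) (hβ0 N)
  · refine (Finset.sum_le_sum fun G _ => max_leakage₁_linearCode_le (M₁ := Fin k₁ → F)
      (M₂ := Fin k₂ → F) (S₁ := Fin l₁ → F) (S₂ := Fin l₂ → F) a₁ b₁ a₂ b₂ a₃ b₃ P₁ P₂ P₃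
      G.1 G.2).trans (h ha₃ hb₃ ?_ ?_)
    · rw [LinearMap.coe_prodMap]
      exact Prod.map_injective.2 ⟨LinearMap.inr_injective, Function.injective_id⟩
    · rw [Fintype.card_prod, Fintype.card_prod, Nat.cast_mul, Nat.cast_mul, card_symbols,
        card_symbols, card_symbols, ← Real.exp_add, ← Real.exp_add, Real.exp_le_exp]
      have h1 := hs₁.le_total
      have h2 := hs₂.le_total
      have e1 := mul_le_mul_of_nonneg_left hR (Nat.cast_nonneg (α := ℝ) N)
      linarith

theorem exists_sum_leakage₂_le {F : Type u} [Field F] [Fintype F] (a₁ b₁ a₂ b₂ : F) {a₃ b₃ : F}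
    (P₁ P₂ P₃ : PMF F) (ha₃ : a₃ ≠ 0) (hb₃ : b₃ ≠ 0) {R : ℝ × ℝ}
    (hR : R.2 ≤ Real.log (Fintype.card F) + entropy P₃ - entropy P₁ - entropy P₂)
    {δ : ℝ} (hδ : 0 < δ) :
    ∃ β : ℕ → ℝ, Tendsto β atTop (𝓝 0) ∧ ∀ N k₁ l₁ k₂ l₂ : ℕ,
      SymbolCounts (Real.log (Fintype.card F)) (Real.log (Fintype.card F) - entropy P₂) R.1 δ
        N k₁ l₁ →
      SymbolCounts (Real.log (Fintype.card F)) (Real.log (Fintype.card F) - entropy P₁) R.2 δ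
        N k₂ l₂ →
      ∑ G : Generators F N k₁ l₁ k₂ l₂, max ((linearCode a₁ b₁ a₂ b₂ P₁ P₂ G.1 G.2).leakage₂
        (additiveChannel a₁ b₁ a₂ b₂ a₃ b₃ P₁ P₂ P₃)) 0 ≤
        Fintype.card (Generators F N k₁ l₁ k₂ l₂) * β N := by
  obtain ⟨β, hβ, hβ0, h⟩ := exists_sum_divUniform_le P₃ hδ
  refine ⟨β, hβ, fun N k₁ l₁ k₂ l₂ hs₁ hs₂ => ?_⟩
  rcases hs₂.message_le with rfl | hm
  · have hz : ∀ G : Generators F N k₁ l₁ 0 l₂, (linearCode a₁ b₁ a₂ b₂ P₁ P₂ G.1 G.2).leakage₂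
        (additiveChannel a₁ b₁ a₂ b₂ a₃ b₃ P₁ P₂ P₃) = 0 := fun G =>
      haveI : Subsingleton (Fin (linearCode a₁ b₁ a₂ b₂ P₁ P₂ G.1 G.2).L₂) :=
        (Fintype.equivFin (Fin 0 → F)).symm.subsingleton
      mutualInfo_of_subsingleton _
    simp only [hz, max_self, Finset.sum_const_zero]
    exact mul_nonneg (Nat.cast_nonneg _) (hβ0 N)
  · refine (Finset.sum_le_sum fun G _ => max_leakage₂_linearCode_le (M₁ := Fin k₁ → F)
      (M₂ := Fin k₂ → F) (S₁ := Fin l₁ → F) (S₂ := Fin l₂ → F) a₁ b₁ a₂ b₂ a₃ b₃ P₁ P₂ P₃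
      G.1 G.2).trans (h ha₃ hb₃ ?_ ?_)
    · rw [LinearMap.coe_prodMap]
      exact Prod.map_injective.2 ⟨Function.injective_id, LinearMap.inr_injective⟩
    · rw [Fintype.card_prod, Fintype.card_prod, Nat.cast_mul, Nat.cast_mul, card_symbols,
        card_symbols, card_symbols, ← Real.exp_add, ← Real.exp_add, Real.exp_le_exp]
      have h1 := hs₁.le_total
      have h2 := hs₂.le_total
      have e1 := mul_le_mul_of_nonneg_left hR (Nat.cast_nonneg (α := ℝ) N)
      linarith

end Achievability

end TwoWayWiretap

end

theorem corollary1 {F : Type*} [Field F] [Fintype F]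
    (a₁ b₁ a₂ b₂ a₃ b₃ : F)
    (ha₁ : a₁ ≠ 0) (hb₁ : b₁ ≠ 0) (ha₂ : a₂ ≠ 0) (hb₂ : b₂ ≠ 0) (ha₃ : a₃ ≠ 0) (hb₃ : b₃ ≠ 0)
    (P₁ P₂ P₃ : PMF F) :
    TwoWayWiretap.regionJ P₁ P₂ P₃ ⊆
        TwoWayWiretap.jointCapacityRegion
          (TwoWayWiretap.additiveChannel a₁ b₁ a₂ b₂ a₃ b₃ P₁ P₂ P₃) ∧
      TwoWayWiretap.regionI P₁ P₂ P₃ ⊆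
        TwoWayWiretap.individualCapacityRegion
          (TwoWayWiretap.additiveChannel a₁ b₁ a₂ b₂ a₃ b₃ P₁ P₂ P₃) := by
  refine ⟨fun R hR => ?_, fun R hR => ?_⟩
  · obtain ⟨hR₁, hR₂, hc₁, hc₂, hsum⟩ := hR
    obtain ⟨C, ε, h₁, h₂, hε, he, hl⟩ := TwoWayWiretap.exists_codes (a₁ := a₁) (b₂ := b₂) a₃ b₃ P₃
      hb₁ ha₂ hR₁ hR₂ hc₁ hc₂
      (fun N C => max (C.leakage (TwoWayWiretap.additiveChannel a₁ b₁ a₂ b₂ a₃ b₃ P₁ P₂ P₃)) 0)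
      (fun _ _ => le_max_right _ _) fun δ hδ =>
        TwoWayWiretap.exists_sum_leakage_le a₁ b₁ a₂ b₂ P₁ P₂ P₃ ha₃ hb₃ hR₁ hR₂ hsum hδ
    exact ⟨C, ε, ε, h₁, h₂, hε, hε, he, fun n => (le_max_left _ _).trans (hl n)⟩
  · obtain ⟨hR₁, hR₂, hc₁, hc₂, hmax⟩ := hR
    obtain ⟨C, ε, h₁, h₂, hε, he, hl⟩ := TwoWayWiretap.exists_codes (a₁ := a₁) (b₂ := b₂) a₃ b₃ P₃
      hb₁ ha₂ hR₁ hR₂ hc₁ hc₂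
      -- The two individual leakages are added so that the same code keeps both small.
      (fun N C =>
        max (C.leakage₁ (TwoWayWiretap.additiveChannel a₁ b₁ a₂ b₂ a₃ b₃ P₁ P₂ P₃)) 0 +
        max (C.leakage₂ (TwoWayWiretap.additiveChannel a₁ b₁ a₂ b₂ a₃ b₃ P₁ P₂ P₃)) 0)
      (fun _ _ => add_nonneg (le_max_right _ _) (le_max_right _ _)) (by
        intro δ hδ
        obtain ⟨β, hβ, h⟩ := TwoWayWiretap.exists_sum_leakage₁_le a₁ b₁ a₂ b₂ P₁ P₂ P₃ ha₃ hb₃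
          ((le_max_left _ _).trans hmax) hδ
        obtain ⟨β', hβ', h'⟩ := TwoWayWiretap.exists_sum_leakage₂_le a₁ b₁ a₂ b₂ P₁ P₂ P₃ ha₃ hb₃
          ((le_max_right _ _).trans hmax) hδ
        refine ⟨fun N => β N + β' N, by simpa using hβ.add hβ', fun N k₁ l₁ k₂ l₂ hs₁ hs₂ => ?_⟩
        rw [Finset.sum_add_distrib, mul_add]
        exact add_le_add (h N _ _ _ _ hs₁ hs₂) (h' N _ _ _ _ hs₁ hs₂))
    refine ⟨C, ε, ε, h₁, h₂, hε, hε, he, fun n => ?_, fun n => ?_⟩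
    · exact (le_max_left _ 0).trans
        ((le_add_of_nonneg_right (le_max_right _ _)).trans (hl n))
    · exact (le_max_left _ 0).trans
        ((le_add_of_nonneg_left (le_max_right _ _)).trans (hl n))
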